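/- **Setting.** A communication schedule among $n$ nodes consists of finitely many transmissions, each made by a node at some time and received, after positive delays, by finitely many nodes at finitely many times, and of $k$ messages $m_1,\dots,m_k\in\mathbf F_q^l$, each generated at finitely many nodes and times. Its time expanded hypergraph $G$ has a vertex $v_t$ whenever node $v$ sends, receives or generates a packet at time $t$, and a supersource $s$. It has one hyperedge for every transmission, from the sender's copy at the sending time to the receivers' copies at the arrival times, and one for every message, from $s$ to the copies at which the message is generated. A network coding protocol $X$ lets every node keep packets in memory cells, which are initially empty; message $m_i$ is the packet $(e_i,m_i)\in\mathbf F_q^{k+l}$. At $v_t$ the packets at hand are those in the memory of $v$ before time $t$ and those arriving at $v$ at time $t$. Every packet sent at $v_t$, and the new content of every cell of $v$, is formed from the packets at hand by storing (at most one of them is taken over unchanged) and coding (a linear combination of a prescribed subset, with independent uniform coefficients from $\mathbf F_q$, is added). The prescriptions may depend on the schedule, but not on packet contents or coefficients. The amount of information transmitted from the sources to $v$ by time $t$ is the dimension of the span of the packets at hand at $v_t$. The transform $G_X$ has as vertices $s$, the copies $v_t$, and one vertex for each sending or cell-update operation. Each message, each transmission, and each memory cell between consecutive copies of a node gives one hyperedge,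 which leaves the vertex of the operation that formed the packet ($s$ for a message) and enters all copies at which the packet is at hand and all operations there that use it. Specific protocols and their transforms are: - *PNC*: nodes store every packet they receive and send random linear combinations of all packets they have. $G_{PNC}$ is $G$ with every hyperedge extended to all future copies of its recipients. - *$\mu$-recombinator*: at each $v_t$ the $\mu$ stored packets are replaced by $\mu$ random linear combinations of the packets at hand, and packets sent are such combinations too. $G_{\mu\text{-recombinator}}$ is $G$ with $\mu$ parallel edges added from each copy to the next copy of the same node. - *$\mu$-accumulator*: random multiples of the arriving packets are added to each of the $\mu$ stored packets individually, and packets sent are random linear combinations of the packets at hand. $G_{\mu\text{-accumulator}}$ is obtained from $G$ by adding $\mu$ memory vertices to each copy $v_t$, which every hyperedge entering $v_t$ also enters, and one hyperedge from each memory vertex to the next copy of the node and to the corresponding memory vertex there. The $(s,x)$-min-cut in a hypergraph is the least number of hyperedges that leave a vertex set containing $s$ but not $x$ (tail inside, some head outside). **Lemma 3.** For every polynomial $P$ and every $c\in\mathbb N$ there is a constant $C>0$ such that the following holds. Let $\log q\ge C\log n$ (so $\log q=\Theta(\log n)$ with a sufficiently large constant suffices). Let $X$ be any network coding protocol on a schedule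 with $n$ nodes that performs at most $P(n)$ coding operations (operations using random coefficients), with transform $G_X$ of the schedule's hypergraph $G$, and let $v_t$ be any vertex of $G$. Then, with probability at least $1-\epsilon$ with $\epsilon=n^{-c}$, the amount of information transmitted from the sources to node $v$ by time $t$ is exactly the $(s,v_t)$-min-cut in $G_X$. The same holds for PNC, the $\mu$-recombinator and the $\mu$-accumulator ($\mu\ge 0$ arbitrary), with the transforms $G_{PNC}$, $G_{\mu\text{-recombinator}}$ and $G_{\mu\text{-accumulator}}$ given above. -/

import Mathlib

/-! ### Directed hypergraphs and their min-cuts -/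

/-- A directed hypergraph: every hyperedge leaves one vertex and enters a set of vertices.
Hyperedges are a family, so parallel ones are allowed. -/
structure DirHypergraph where
  Vtx : Type
  Edge : Type
  tail : Edge → Vtx
  heads : Edge → Set Vtx

/-- The hyperedges that leave the vertex set `W`. -/
def DirHypergraph.cutEdges (H : DirHypergraph) (W : Set H.Vtx) : Set H.Edge :=
  {e | H.tail e ∈ W ∧ ∃ y ∈ H.heads e, y ∉ W}

/-- The `(s, x)`-min-cut (unit capacities): the least number of hyperedges leaving a set of
vertices that contains `s` and does not contain `x`. -/
noncomputable def DirHypergraph.minCut (H : DirHypergraph) (s x : H.Vtx) : ℕ :=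
  sInf {c | ∃ W : Set H.Vtx, s ∈ W ∧ x ∉ W ∧ (H.cutEdges W).ncard = c}

/-! ### Communication schedules -/

/-- A communication schedule among `n` nodes in which `k` messages are generated. Transmission
`e` is made by node `sender e` at time `sendTime e`; it is received by `u` at time `t'` for all
`(u, t') ∈ recv e`, after positive delays. Message `i` is generated at the nodes and times
`(u, t') ∈ gen i`. -/
structure Schedule (n k : ℕ) where
  numTx : ℕ
  sender : Fin numTx → Fin n
  sendTime : Fin numTx → ℝ
  recv : Fin numTx → Finset (Fin n × ℝ)
  delay_pos : ∀ e, ∀ p ∈ recv e, sendTime e < p.2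
  gen : Fin k → Finset (Fin n × ℝ)

namespace Schedule

variable {n k : ℕ} (G : Schedule n k)

/-- The packets that nodes obtain from outside: the messages and the transmissions. -/
abbrev Ext : Type := Fin k ⊕ Fin G.numTx

/-- Where and when a message or a transmission arrives. -/
def arr : G.Ext → Finset (Fin n × ℝ) := Sum.elim G.gen G.recv

/-- The node and time at which a transmission is made. -/
def origin (e : Fin G.numTx) : Fin n × ℝ := (G.sender e, G.sendTime e)

/-- The copies `v_t`: all pairs of a node `v` and a time `t` at which `v` sends a packet, or
receives or generates one. -/
noncomputable def copies : Finset (Fin n × ℝ) :=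
  Finset.univ.image G.origin ∪ Finset.univ.biUnion G.arr

/-- The vertices `v_t` of the time expanded hypergraph, without the supersource. -/
abbrev Copy : Type := {x : Fin n × ℝ // x ∈ G.copies}

/-- The vertex from which a transmission is made. -/
noncomputable def originCopy (e : Fin G.numTx) : G.Copy :=
  ⟨G.origin e, Finset.mem_union_left _ (Finset.mem_image_of_mem _ (Finset.mem_univ e))⟩

/-- `y` is the next copy in time of the node of `x`. -/
def IsNext (x y : G.Copy) : Prop :=
  x.1.1 = y.1.1 ∧ x.1.2 < y.1.2 ∧ ∀ z : G.Copy, z.1.1 = x.1.1 → x.1.2 < z.1.2 → y.1.2 ≤ z.1.2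

/-- The pairs of a copy `v_t` and the next copy `v_{t'}` of the same node. -/
abbrev MemStep : Type := {p : G.Copy × G.Copy // G.IsNext p.1 p.2}

/-- The time expanded hypergraph with supersource `none`: one hyperedge for every message, from
the supersource, and one for every transmission. -/
noncomputable def timeExpanded : DirHypergraph where
  Vtx := Option G.Copy
  Edge := G.Ext
  tail := Sum.elim (fun _ => none) (fun e => some (G.originCopy e))
  heads a := {y | ∃ c : G.Copy, y = some c ∧ c.1 ∈ G.arr a}

/-! ### Network coding protocols and their execution -/

/-- A network coding protocol run on the schedule `G`. Every node has memory cells `Slot`. At a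
copy `v_t` the packets at hand, indexed by `Slot ⊕ G.Ext`, are those in the memory of `v` and those
that arrive at `v` at time `t`. The protocol has one operation for every transmission, which forms
the packet to be sent, and one for every copy `v_t` and every cell, which forms the packet that is
in this cell of `v` after time `t`. Operation `o` takes over the packet `keep o`, if any,
unchanged, and adds a random linear combination of the packets `mix o`. So `mix o = ∅` is
storing (or forwarding) and `keep o = none` is coding. -/
structure Protocol where
  Slot : Type
  [fintypeSlot : Fintype Slot]
  [decEqSlot : DecidableEq Slot]
  keep : (G.Copy × Slot) ⊕ Fin G.numTx → Option (Slot ⊕ G.Ext)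
  mix : (G.Copy × Slot) ⊕ Fin G.numTx → Finset (Slot ⊕ G.Ext)

attribute [instance] Protocol.fintypeSlot Protocol.decEqSlot

end Schedule

/-- Packets: a coefficient vector in `F ^ k` followed by a payload in `F ^ l`. -/
abbrev Packet (F : Type) (k l : ℕ) : Type := (Fin k → F) × (Fin l → F)

namespace Schedule.Protocol

variable {n k : ℕ} {G : Schedule n k} (X : G.Protocol)

/-- The operations of the protocol. -/
abbrev Op : Type := (G.Copy × X.Slot) ⊕ Fin G.numTx

/-- The indices of the packets at hand at a copy. -/
abbrev Input : Type := X.Slot ⊕ G.Ext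

/-- The choices of all coding coefficients. -/
abbrev Coeffs (F : Type) : Type := X.Op → X.Input → F

/-- The packets that an operation takes over or combines. -/
def inputs (o : X.Op) : Set X.Input := {y | X.keep o = some y ∨ y ∈ X.mix o}

/-- The copy at which an operation takes place. -/
noncomputable def loc : X.Op → G.Copy := Sum.elim Prod.fst G.originCopy

/-- The number of coding operations, that is, of those that use random coefficients. -/
noncomputable def numCoding : ℕ := {o : X.Op | (X.mix o).Nonempty}.ncard

variable {F : Type} [Field F] {l : ℕ}

/-- The result of operation `o` with coefficients `ω`, applied to the packets at hand. -/
def result (ω : X.Coeffs F) (o : X.Op) (p : X.Input → Packet F k l) : Packet F k l :=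
  (X.keep o).elim 0 p + ∑ y ∈ X.mix o, ω o y • p y

/-- A state of the network: the packets in the memories of the nodes and the contents of the
messages and of the packets sent so far (`0` for an empty cell and for a packet not yet sent). -/
structure State (F : Type) (l : ℕ) where
  mem : Fin n → X.Slot → Packet F k l
  ext : G.Ext → Packet F k l

/-- The initial state: all memories are empty, and message `i` is the packet `(e_i, msg i)`. -/
def init (msg : Fin k → Fin l → F) : X.State F l where
  mem _ _ := 0
  ext := Sum.elim (fun i => (Pi.single i 1, msg i)) (fun _ => 0)

/-- The packets at hand at node `v` at time `t`: its memory (as left by the events before `t`) and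
the packets that arrive at `v` at time `t`. -/
noncomputable def State.atHand {X : G.Protocol} (S : X.State F l) (x : Fin n × ℝ) :
    X.Input → Packet F k l :=
  Sum.elim (S.mem x.1) (fun a => if x ∈ G.arr a then S.ext a else 0)

/-- The events at time `t`: every node that has a copy at time `t` sends its packets and updates
its memory. -/
noncomputable def step (ω : X.Coeffs F) (S : X.State F l) (t : ℝ) : X.State F l where
  mem v j := if h : (v, t) ∈ G.copies
    then X.result ω (Sum.inl (⟨(v, t), h⟩, j)) (S.atHand (v, t)) else S.mem v j
  ext := Sum.elim (fun i => S.ext (Sum.inl i)) (fun e => if G.sendTime e = t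
    then X.result ω (Sum.inr e) (S.atHand (G.sender e, t)) else S.ext (Sum.inr e))

/-- The state of the network after all events before time `t`, processed in order of time. -/
noncomputable def stateBefore (ω : X.Coeffs F) (msg : Fin k → Fin l → F) (t : ℝ) : X.State F l :=
  (((G.copies.image Prod.snd).filter (· < t)).sort (· ≤ ·)).foldl (X.step ω) (X.init msg)

/-- The amount of information transmitted from the sources to node `v` by time `t`, in packets,
for `x = (v, t)`: the dimension of the span of the packets that `v` has at time `t`. -/
noncomputable def information (ω : X.Coeffs F) (msg : Fin k → Fin l → F) (x : G.Copy) : ℕ :=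
  Module.finrank F
    (Submodule.span F (Set.range ((X.stateBefore ω msg x.1.2).atHand x.1)))

/-- The probability of an event when all coding coefficients are independent and uniform. -/
noncomputable def prob [Fintype F] (E : Set (X.Coeffs F)) : ℝ :=
  (E.ncard : ℝ) / (Nat.card (X.Coeffs F) : ℝ)

end Schedule.Protocol

namespace Schedule

variable {n k : ℕ} (G : Schedule n k)

/-! ### The transform of a general protocol -/

/-- The vertices of the transform of `X`: the supersource, the copies `v_t`, and one coding vertex
for every operation. -/
inductive Protocol.TVertex {G : Schedule n k} (X : G.Protocol) : Type
  | source : X.TVertex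
  | copy : G.Copy → X.TVertex
  | op : X.Op → X.TVertex

/-- The transform of the time expanded hypergraph for a protocol `X`. The hyperedges are the
messages, the transmissions, and for every cell a memory edge from each copy of a node to the next
one. Each leaves the vertex of the operation that forms the packet (the supersource, for a message)
and enters every copy at which the packet is at hand and every operation there that uses it. -/
noncomputable def Protocol.transform {G : Schedule n k} (X : G.Protocol) : DirHypergraph where
  Vtx := X.TVertex
  Edge := G.Ext ⊕ (G.MemStep × X.Slot)
  tail
    | Sum.inl (Sum.inl _) => .source
    | Sum.inl (Sum.inr e) => .op (Sum.inr e)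
    | Sum.inr (p, j) => .op (Sum.inl (p.1.1, j))
  heads
    | Sum.inl a => {y | (∃ c : G.Copy, y = .copy c ∧ c.1 ∈ G.arr a) ∨
        ∃ o : X.Op, y = .op o ∧ (X.loc o).1 ∈ G.arr a ∧ Sum.inr a ∈ X.inputs o}
    | Sum.inr (p, j) => {y | y = .copy p.1.2 ∨
        ∃ o : X.Op, y = .op o ∧ X.loc o = p.1.2 ∧ Sum.inl j ∈ X.inputs o}

/-! ### PNC, the recombinator and the accumulator -/

/-- PNC: a node stores every packet that it receives and sends random linear combinations of all
packets that it has. There is one cell for each packet that may arrive. -/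
noncomputable def pnc : G.Protocol where
  Slot := G.Ext
  keep
    | Sum.inl (x, a) => if x.1 ∈ G.arr a then some (Sum.inr a) else some (Sum.inl a)
    | Sum.inr _ => none
  mix
    | Sum.inl _ => ∅
    | Sum.inr _ => Finset.univ

/-- The PNC transform: every hyperedge of the time expanded hypergraph is replaced by its memory
closure, which enters all future copies of the recipients as well. -/
noncomputable def pncTransform : DirHypergraph where
  Vtx := Option G.Copy
  Edge := G.Ext
  tail := G.timeExpanded.tail
  heads a := {y | ∃ c d : G.Copy, y = some d ∧ some c ∈ G.timeExpanded.heads a ∧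
    c.1.1 = d.1.1 ∧ c.1.2 ≤ d.1.2}

/-- The `μ`-recombinator: at every copy `v_t`, the `μ` stored packets are replaced by `μ` random
linear combinations of the stored and the arriving packets, and the packets sent are random linear
combinations of the same. -/
def recombinator (μ : ℕ) : G.Protocol where
  Slot := Fin μ
  keep _ := none
  mix _ := Finset.univ

/-- The `μ`-recombinator transform: `μ` edges are added from every copy to the next copy of the
same node. -/
noncomputable def recombinatorTransform (μ : ℕ) : DirHypergraph where
  Vtx := Option G.Copy
  Edge := G.Ext ⊕ (G.MemStep × Fin μ)
  tail := Sum.elim G.timeExpanded.tail (fun p => some p.1.1.1)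
  heads := Sum.elim G.timeExpanded.heads (fun p => {some p.1.1.2})

/-- The `μ`-accumulator: random multiples of the arriving packets are added to each of the `μ`
stored packets individually, and the packets sent are random linear combinations of all packets
that the node has. -/
noncomputable def accumulator (μ : ℕ) : G.Protocol where
  Slot := Fin μ
  keep
    | Sum.inl (_, j) => some (Sum.inl j)
    | Sum.inr _ => none
  mix
    | Sum.inl (x, _) => (Finset.univ.filter (fun a : G.Ext => x.1 ∈ G.arr a)).map .inr
    | Sum.inr _ => Finset.univ

/-- The vertices of the accumulator transform: the supersource, the copies `v_t`, from which packets
are transmitted, and `μ` memory vertices for every copy. -/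
inductive AccVertex {n k : ℕ} (G : Schedule n k) (μ : ℕ) : Type
  | source : AccVertex G μ
  | copy : G.Copy → AccVertex G μ
  | cell : G.Copy → Fin μ → AccVertex G μ

/-- The `μ`-accumulator transform: a hyperedge of the time expanded hypergraph that enters a copy
enters its `μ` memory vertices as well, and each memory vertex has one hyperedge to the next copy
of the node and to the corresponding memory vertex there. -/
noncomputable def accumulatorTransform (μ : ℕ) : DirHypergraph where
  Vtx := AccVertex G μ
  Edge := G.Ext ⊕ (G.MemStep × Fin μ)
  tail
    | Sum.inl (Sum.inl _) => .source
    | Sum.inl (Sum.inr e) => .copy (G.originCopy e)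
    | Sum.inr (p, j) => .cell p.1.1 j
  heads
    | Sum.inl a => {y | ∃ c : G.Copy, c.1 ∈ G.arr a ∧ (y = .copy c ∨ ∃ j, y = .cell c j)}
    | Sum.inr (p, j) => {.copy p.1.2, .cell p.1.2 j}

end Schedule

/-! A packet is identified with the message or operation that forms it. A set `U` of operations on
the sink side gives a cut, crossed by the packets that feed `U` or the sink but are not formed in
`U`. The upper bound is deterministic: everything at the sink lies in the span of the crossing
packets (`IsExecution.finrank_le`).

For the lower bound, operations are carried out one by one in order of time, and a cut is measured
by `mixedCut`: packets already formed contribute the rank of their vectors, packets still to come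
count one each. Initially only the messages are known; they are independent, so this is the ordinary
cut capacity. At the end only `U = ∅` remains and the value is the rank at the sink. It therefore
suffices that the minimum rarely drops.

One operation can lower it only if the new vector falls into the span of the vectors crossing a
tight cut. There may be exponentially many tight cuts, but by submodularity they have a largest
member, whose span `A` contains all the others. Minimality forces some input of the operation to lie
outside `A` (`exists_submodule_of_mixedCut_lt`). If that input carries a random coefficient, at most
one value of this coefficient puts the result into `A`; if only the kept packet lies outside, the
result never enters `A`. Each coding operation thus fails with probability at most `1 / q`, storing
never fails, and a union bound over coding operations gives `one_sub_le_prob`.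

The special transforms arise from the general one by merging vertices or chains of memory edges,
which preserves the min-cut. -/

/-! ### Cuts in which a part of the hyperedges carry vectors -/

section MixedCut

variable {E : Type*} (feeds : E → Set E) (T : Set E)

/-- The hyperedges that enter a set `U` of operations or the sink, whose inputs are `T`. -/
def entering (U : Set E) : Set E := T ∪ ⋃ e ∈ U, feeds e

lemma mem_entering {U : Set E} {e : E} :
    e ∈ entering feeds T U ↔ e ∈ T ∨ ∃ o ∈ U, e ∈ feeds o := by
  simp [entering]

lemma entering_union (U U' : Set E) :
    entering feeds T (U ∪ U') = entering feeds T U ∪ entering feeds T U' := by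
  ext e
  simp only [mem_entering, Set.mem_union]
  grind

lemma entering_mono {U U' : Set E} (h : U ⊆ U') : entering feeds T U ⊆ entering feeds T U' := by
  intro e
  simp only [mem_entering]
  grind

variable (K : Type*) {V : Type*} [Field K] [AddCommGroup V] [Module K V]

/-- The capacity of a cut when the hyperedges in `D` already carry the vectors `v`: the rank of
the vectors that cross it plus the number of the other hyperedges that cross it. -/
noncomputable def mixedCut (v : E → V) (D U : Set E) : ℕ :=
  Module.finrank K (Submodule.span K (v '' (entering feeds T U ∩ D))) +
    (entering feeds T U \ (D ∪ U)).ncard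

lemma mixedCut_congr {v v' : E → V} {D : Set E} (h : ∀ e ∈ D, v e = v' e) (U : Set E) :
    mixedCut feeds T K v D U = mixedCut feeds T K v' D U := by
  unfold mixedCut
  rw [Set.image_congr (fun e he => h e he.2)]

/-- The rank part is submodular by the dimension formula for sums and intersections of subspaces.
The counting part follows from one inclusion for unions and one for intersections of the sets of
crossing hyperedges. -/
lemma mixedCut_submodular [Finite E] (v : E → V) (D U U' : Set E) :
    mixedCut feeds T K v D (U ∪ U') + mixedCut feeds T K v D (U ∩ U') ≤
      mixedCut feeds T K v D U + mixedCut feeds T K v D U' := by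
  unfold mixedCut
  set A := Submodule.span K (v '' (entering feeds T U ∩ D)) with hA
  set A' := Submodule.span K (v '' (entering feeds T U' ∩ D)) with hA'
  have : FiniteDimensional K A := FiniteDimensional.span_of_finite K (Set.toFinite _)
  have : FiniteDimensional K A' := FiniteDimensional.span_of_finite K (Set.toFinite _)
  have h1 : Submodule.span K (v '' (entering feeds T (U ∪ U') ∩ D)) = A ⊔ A' := by
    rw [entering_union, Set.union_inter_distrib_right, Set.image_union, Submodule.span_union]
  have h2 : Submodule.span K (v '' (entering feeds T (U ∩ U') ∩ D)) ≤ A ⊓ A' := by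
    refine le_inf (Submodule.span_mono (Set.image_mono (Set.inter_subset_inter_left _ ?_)))
      (Submodule.span_mono (Set.image_mono (Set.inter_subset_inter_left _ ?_)))
    · exact entering_mono _ _ Set.inter_subset_left
    · exact entering_mono _ _ Set.inter_subset_right
  have h3 := Submodule.finrank_sup_add_finrank_inf_eq A A'
  have h4 := Submodule.finrank_mono h2
  rw [h1]
  set Q := entering feeds T U \ (D ∪ U)
  set Q' := entering feeds T U' \ (D ∪ U')
  set R := entering feeds T (U ∪ U') \ (D ∪ (U ∪ U')) with hR
  set R' := entering feeds T (U ∩ U') \ (D ∪ (U ∩ U')) with hR'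
  have hl := @entering_mono E feeds T (U ∩ U') U Set.inter_subset_left
  have hr := @entering_mono E feeds T (U ∩ U') U' Set.inter_subset_right
  have h5 : R ∪ R' ⊆ Q ∪ Q' := by
    rw [hR, entering_union]
    intro e he
    have := @hl e
    have := @hr e
    simp only [Q, Q', R', Set.mem_union, Set.mem_sdiff, Set.mem_inter_iff] at he ⊢
    tauto
  have h6 : R ∩ R' ⊆ Q ∩ Q' := by
    rw [hR, entering_union]
    intro e he
    have := @hl e
    have := @hr e
    simp only [Q, Q', R', Set.mem_union, Set.mem_sdiff, Set.mem_inter_iff] at he ⊢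
    tauto
  have h7 := Set.ncard_le_ncard h5 (Set.toFinite _)
  have h8 := Set.ncard_le_ncard h6 (Set.toFinite _)
  have h9 := Set.ncard_union_add_ncard_inter R R'
  have h10 := Set.ncard_union_add_ncard_inter Q Q'
  omega

/-- If the cut capacities drop below `m` when hyperedge `o` obtains its vector, then this vector
lies in a subspace that depends on the previous vectors only and omits an input of `o`. -/
lemma exists_submodule_of_mixedCut_lt [Finite E] (v : E → V) (D : Set E) {o : E} (ho : o ∉ D)
    (hfeeds : feeds o ⊆ D) {m : ℕ} (hm : ∀ U, Disjoint U D → m ≤ mixedCut feeds T K v D U) :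
    ∃ A : Submodule K V, ∀ v' : E → V, (∀ e ∈ D, v' e = v e) →
      (∃ U, Disjoint U (insert o D) ∧ mixedCut feeds T K v' (insert o D) U < m) →
      v' o ∈ A ∧ ∃ e ∈ feeds o, v e ∉ A := by
  -- The tight cuts entered by `o`. Only these can drop: giving `o` its vector removes one unit from
  -- the count, and the rank makes up for it unless the vector lies in the span already present.
  set S : Set (Set E) := {U | Disjoint U D ∧ o ∉ U ∧ o ∈ entering feeds T U ∧
    mixedCut feeds T K v D U = m} with hS
  have key : ∀ v' : E → V, (∀ e ∈ D, v' e = v e) → ∀ U, Disjoint U (insert o D) →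
      mixedCut feeds T K v' (insert o D) U < m →
      U ∈ S ∧ v' o ∈ Submodule.span K (v '' (entering feeds T U ∩ D)) := by
    intro v' hv' U hU hlt
    rw [Set.disjoint_insert_right] at hU
    have hmU := hm U hU.2
    by_cases hoU : o ∈ entering feeds T U
    · have e1 : entering feeds T U ∩ insert o D = insert o (entering feeds T U ∩ D) := by
        ext e; simp only [Set.mem_inter_iff, Set.mem_insert_iff]; grind
      have e2 : entering feeds T U \ (D ∪ U) =
          insert o (entering feeds T U \ (insert o D ∪ U)) := by
        ext e; simp only [Set.mem_sdiff, Set.mem_union, Set.mem_insert_iff]; grind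
      have e3 : (entering feeds T U \ (D ∪ U)).ncard =
          (entering feeds T U \ (insert o D ∪ U)).ncard + 1 := by
        rw [e2, Set.ncard_insert_of_notMem (by simp) (Set.toFinite _)]
      have e4 : v' '' (entering feeds T U ∩ D) = v '' (entering feeds T U ∩ D) :=
        Set.image_congr (fun e he => hv' e he.2)
      unfold mixedCut at hlt hmU
      rw [e1, Set.image_insert_eq, e4] at hlt
      have : FiniteDimensional K
          (Submodule.span K (insert (v' o) (v '' (entering feeds T U ∩ D)))) :=
        FiniteDimensional.span_of_finite K (Set.toFinite _)
      have hle : Submodule.span K (v '' (entering feeds T U ∩ D)) ≤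
          Submodule.span K (insert (v' o) (v '' (entering feeds T U ∩ D))) :=
        Submodule.span_mono (Set.subset_insert _ _)
      have h1 := Submodule.finrank_mono hle
      refine ⟨⟨hU.2, hU.1, hoU, ?_⟩, ?_⟩
      · unfold mixedCut; omega
      · rw [Submodule.eq_of_le_of_finrank_eq hle (by omega)]
        exact Submodule.subset_span (Set.mem_insert _ _)
    · exfalso
      have e1 : entering feeds T U ∩ insert o D = entering feeds T U ∩ D := by
        ext e; simp only [Set.mem_inter_iff, Set.mem_insert_iff]; grind
      have e2 : entering feeds T U \ (insert o D ∪ U) = entering feeds T U \ (D ∪ U) := by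
        ext e; simp only [Set.mem_sdiff, Set.mem_union, Set.mem_insert_iff]; grind
      have e4 : v' '' (entering feeds T U ∩ D) = v '' (entering feeds T U ∩ D) :=
        Set.image_congr (fun e he => hv' e he.2)
      unfold mixedCut at hlt hmU
      rw [e1, e2, e4] at hlt
      omega
  by_cases hne : S.Nonempty
  · obtain ⟨M, hMmax⟩ := (Set.toFinite S).exists_maximal hne
    obtain ⟨hMD, hoM, hoM', hMm⟩ := hMmax.prop
    -- Union and intersection both have capacity at least `m`, so submodularity makes the union of
    -- two tight cuts tight. Hence a maximal tight cut contains all of them.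
    have hub : ∀ U ∈ S, U ⊆ M := by
      rintro U ⟨hUD, hoU, hoU', hUm⟩
      have hmem : U ∪ M ∈ S := by
        refine ⟨Set.disjoint_union_left.2 ⟨hUD, hMD⟩, ?_, ?_, ?_⟩
        · simp [hoU, hoM]
        · rw [entering_union]; exact Or.inl hoU'
        · have h1 := mixedCut_submodular feeds T K v D U M
          have h2 := hm (U ∪ M) (Set.disjoint_union_left.2 ⟨hUD, hMD⟩)
          have h3 := hm (U ∩ M) (hUD.mono_left Set.inter_subset_left)
          omega
      exact Set.subset_union_left.trans (hMmax.le_of_ge hmem Set.subset_union_right)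
    refine ⟨Submodule.span K (v '' (entering feeds T M ∩ D)), fun v' hv' ⟨U, hU, hlt⟩ => ?_⟩
    obtain ⟨hUS, hmem⟩ := key v' hv' U hU hlt
    refine ⟨Submodule.span_mono (Set.image_mono (Set.inter_subset_inter_left _
      (entering_mono _ _ (hub U hUS)))) hmem, ?_⟩
    -- If all inputs of `o` lay in the span, moving `o` into `M` would add no rank and save the
    -- hyperedge `o`, leaving a cut of capacity below `m`.
    by_contra! hcon
    have hoD : Disjoint (insert o M) D := by
      rw [Set.disjoint_insert_left]; exact ⟨ho, hMD⟩
    have h1 := hm _ hoD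
    have e0 : entering feeds T (insert o M) = entering feeds T M ∪ feeds o := by
      ext e; simp only [mem_entering, Set.mem_union, Set.mem_insert_iff]; grind
    have e1 : Submodule.span K (v '' (entering feeds T (insert o M) ∩ D)) =
        Submodule.span K (v '' (entering feeds T M ∩ D)) := by
      apply le_antisymm
      · rw [Submodule.span_le, e0]
        rintro _ ⟨e, ⟨he | he, heD⟩, rfl⟩
        · exact Submodule.subset_span ⟨e, ⟨he, heD⟩, rfl⟩
        · exact hcon e he
      · exact Submodule.span_mono (Set.image_mono (Set.inter_subset_inter_left _
          (entering_mono _ _ (Set.subset_insert _ _))))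
    have e2 : entering feeds T M \ (D ∪ M) =
        insert o (entering feeds T (insert o M) \ (D ∪ insert o M)) := by
      rw [e0]
      ext e
      have := @hfeeds e
      simp only [Set.mem_sdiff, Set.mem_union, Set.mem_insert_iff]
      grind
    have e3 : (entering feeds T M \ (D ∪ M)).ncard =
        (entering feeds T (insert o M) \ (D ∪ insert o M)).ncard + 1 := by
      rw [e2, Set.ncard_insert_of_notMem (by simp) (Set.toFinite _)]
    unfold mixedCut at h1 hMm
    rw [e1] at h1
    omega
  -- Without tight cuts entered by `o` no drop is possible, and any subspace serves.
  · refine ⟨⊤, fun v' hv' ⟨U, hU, hlt⟩ => ?_⟩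
    exact absurd ⟨U, (key v' hv' U hU hlt).1⟩ hne

end MixedCut

/-- If in every class of coefficient choices that agree outside of operation `o` the choices in `B`
are determined by the coefficients of `o` other than one, then `B` has density at most `1 / q`. -/
lemma card_mul_ncard_le {O Y F : Type*} [Finite O] [Finite Y] [Field F] [Finite F]
    (o : O) (B : Set (O → Y → F)) (y₀ : (O → Y → F) → Y)
    (hy₀ : ∀ ω ∈ B, ∀ ω' ∈ B, (∀ o' ≠ o, ω o' = ω' o') → y₀ ω = y₀ ω')
    (hB : ∀ ω ∈ B, ∀ ω' ∈ B, (∀ o' ≠ o, ω o' = ω' o') → (∀ y ≠ y₀ ω, ω o y = ω' o y) →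
      ω o (y₀ ω) = ω' o (y₀ ω)) :
    Nat.card F * B.ncard ≤ Nat.card (O → Y → F) := by
  classical
  rw [← Nat.card_coe_set_eq, ← Nat.card_prod]
  -- Shifting the determined coefficient of each element of `B` by all `t` in `F` produces distinct
  -- choices: the image reveals everything but that coefficient, hence `ω`, hence `t`.
  refine Nat.card_le_card_of_injective (fun p : F × B =>
    Function.update p.2.1 o (Function.update (p.2.1 o) (y₀ p.2.1) (p.2.1 o (y₀ p.2.1) + p.1))) ?_
  rintro ⟨t, ω, hω⟩ ⟨t', ω', hω'⟩ h
  simp only at h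
  have h1 : ∀ o' ≠ o, ω o' = ω' o' := by
    intro o' ho'
    simpa [ho'] using congrFun h o'
  have h2 := hy₀ ω hω ω' hω' h1
  have h3 : ∀ y ≠ y₀ ω, ω o y = ω' o y := by
    intro y hy
    simpa [hy, h2 ▸ hy] using congrFun (congrFun h o) y
  have h4 := hB ω hω ω' hω' h1 h3
  have h5 : ω = ω' := by
    funext o' y
    by_cases ho' : o' = o
    · subst ho'
      by_cases hy : y = y₀ ω
      · rw [hy]; exact h4
      · exact h3 y hy
    · rw [h1 o' ho']
  subst h5
  have h6 : t = t' := by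
    simpa using congrFun (congrFun h o) (y₀ ω)
  rw [h6]

lemma Finite.induction_of_real {α : Type*} [Finite α] (f : α → ℝ) {p : α → Prop}
    (h : ∀ a, (∀ b, f b < f a → p b) → p a) (a : α) : p a := by
  let : Preorder α := Preorder.lift f
  exact wellFounded_lt.induction a h

/-! ### Random linear codes on acyclic hypergraphs -/

/-- An acyclic coding scheme: every operation `o` combines inputs indexed by `Y`, where input `y`
is a source, the result of an earlier operation, or empty. -/
structure CodingScheme (I O Y : Type*) where
  keep : O → Option Y
  mix : O → Finset Y
  src : O → Y → Option (I ⊕ O)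
  time : O → ℝ
  time_lt : ∀ o y o', src o y = some (Sum.inr o') → time o' < time o

namespace CodingScheme

variable {I O Y : Type*} (Z : CodingScheme I O Y)

/-- The packets that are used to form a packet. -/
def feeds : I ⊕ O → Set (I ⊕ O) :=
  Sum.elim (fun _ => ∅)
    (fun o => {e | ∃ y, (Z.keep o = some y ∨ y ∈ Z.mix o) ∧ Z.src o y = some e})

/-- The sources and the results of the operations in `S`. -/
def known (S : Set O) : Set (I ⊕ O) := {e | ∀ o, e = Sum.inr o → o ∈ S}

lemma known_insert (o : O) (S : Set O) :
    (known (insert o S) : Set (I ⊕ O)) = insert (Sum.inr o) (known S) := by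
  ext (i | o') <;> simp [known]

/-! ### Executions of a scheme and the deterministic upper bound -/

section Execution

variable {F V : Type*} [Field F] [AddCommGroup V] [Module F V]

/-- The vector at input `y` of operation `o`. -/
def input (v : I ⊕ O → V) (o : O) (y : Y) : V := (Z.src o y).elim 0 v

/-- `v` consists of the sources `b` and the results of the operations with coefficients `ω`. -/
def IsExecution (b : I → V) (ω : O → Y → F) (v : I ⊕ O → V) : Prop :=
  (∀ i, v (Sum.inl i) = b i) ∧ ∀ o, v (Sum.inr o) =
    (Z.keep o).elim 0 (Z.input v o) + ∑ y ∈ Z.mix o, ω o y • Z.input v o y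

variable {Z}

lemma input_congr {v v' : I ⊕ O → V} {o : O} {D : Set (I ⊕ O)} (h : Z.feeds (Sum.inr o) ⊆ D)
    (hv : ∀ e ∈ D, v e = v' e) {y : Y} (hy : Z.keep o = some y ∨ y ∈ Z.mix o) :
    Z.input v o y = Z.input v' o y := by
  unfold input
  cases hs : Z.src o y with
  | none => rfl
  | some e => exact hv e (h ⟨y, hy, hs⟩)

lemma result_congr {v v' : I ⊕ O → V} {o : O} {D : Set (I ⊕ O)} (h : Z.feeds (Sum.inr o) ⊆ D)
    (hv : ∀ e ∈ D, v e = v' e) (c : Y → F) :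
    (Z.keep o).elim 0 (Z.input v o) + ∑ y ∈ Z.mix o, c y • Z.input v o y =
      (Z.keep o).elim 0 (Z.input v' o) + ∑ y ∈ Z.mix o, c y • Z.input v' o y := by
  congr 1
  · cases hk : Z.keep o with
    | none => rfl
    | some y => exact input_congr h hv (Or.inl hk)
  · exact Finset.sum_congr rfl fun y hy => by rw [input_congr h hv (Or.inr hy)]

/-- Induction on time: a set closed under taking inputs computes its results from its own
coefficients. In particular, the coefficients of a later operation do not influence the vectors
known before it. -/
lemma IsExecution.congr [Finite O] {b : I → V} {ω ω' : O → Y → F} {v v' : I ⊕ O → V}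
    (hv : Z.IsExecution b ω v) (hv' : Z.IsExecution b ω' v') {S : Set O}
    (hS : ∀ o ∈ S, Z.feeds (Sum.inr o) ⊆ known S) (hω : ∀ o ∈ S, ω o = ω' o) :
    ∀ e ∈ known S, v e = v' e := by
  have key : ∀ o, o ∈ S → v (Sum.inr o) = v' (Sum.inr o) := by
    intro o
    induction o using Finite.induction_of_real Z.time with
    | h o ih =>
      intro ho
      rw [hv.2, hv'.2, hω o ho]
      refine result_congr subset_rfl ?_ _
      rintro (i | o') he
      · rw [hv.1, hv'.1]
      · have hmem := hS o ho he o' rfl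
        obtain ⟨y, -, hy⟩ := he
        exact ih o' (Z.time_lt _ _ _ hy) hmem
  rintro (i | o) he
  · rw [hv.1, hv'.1]
  · exact key o (he o rfl)

/-- The rank at the sink is at most the capacity of every cut. -/
lemma IsExecution.finrank_le [Finite I] [Finite O] {b : I → V} {ω : O → Y → F} {v : I ⊕ O → V}
    (hv : Z.IsExecution b ω v) (T U : Set (I ⊕ O)) (hU : U ⊆ Set.range Sum.inr) :
    Module.finrank F (Submodule.span F (v '' T)) ≤ (entering Z.feeds T U \ U).ncard := by
  set A := Submodule.span F (v '' (entering Z.feeds T U \ U)) with hA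
  have : FiniteDimensional F A := FiniteDimensional.span_of_finite F (Set.toFinite _)
  -- A packet formed inside `U` is a combination of earlier packets that again enter `U`; tracing
  -- back in time ends at packets formed outside `U`.
  have key : ∀ o, Sum.inr o ∈ entering Z.feeds T U → v (Sum.inr o) ∈ A := by
    intro o
    induction o using Finite.induction_of_real Z.time with
    | h o ih =>
      intro ho
      by_cases hoU : Sum.inr o ∈ U
      · have hin : ∀ y, (Z.keep o = some y ∨ y ∈ Z.mix o) → Z.input v o y ∈ A := by
          intro y hy
          unfold input
          cases hs : Z.src o y with
          | none => exact A.zero_mem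
          | some e =>
            have he : e ∈ entering Z.feeds T U :=
              (mem_entering _ _).2 (Or.inr ⟨_, hoU, y, hy, hs⟩)
            rcases e with i | o'
            · refine Submodule.subset_span ⟨_, ⟨he, fun hi => ?_⟩, rfl⟩
              obtain ⟨_, h⟩ := hU hi
              cases h
            · exact ih o' (Z.time_lt _ _ _ hs) he
        rw [hv.2]
        refine A.add_mem ?_ (A.sum_mem fun y hy => A.smul_mem _ (hin y (Or.inr hy)))
        cases hk : Z.keep o with
        | none => exact A.zero_mem
        | some y => exact hin y (Or.inl hk)
      · exact Submodule.subset_span ⟨_, ⟨ho, hoU⟩, rfl⟩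
  have hle : Submodule.span F (v '' T) ≤ A := by
    rw [Submodule.span_le]
    rintro _ ⟨e, he, rfl⟩
    have he' : e ∈ entering Z.feeds T U := Or.inl he
    rcases e with i | o
    · refine Submodule.subset_span ⟨_, ⟨he', fun hi => ?_⟩, rfl⟩
      obtain ⟨_, h⟩ := hU hi
      cases h
    · exact key o he'
  refine (Submodule.finrank_mono hle).trans ?_
  have := Fintype.ofFinite ↥(v '' (entering Z.feeds T U \ U))
  have h1 := finrank_span_le_card (R := F) (v '' (entering Z.feeds T U \ U))
  rw [← Set.ncard_eq_toFinset_card'] at h1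
  exact h1.trans (Set.ncard_image_le (Set.toFinite _))

end Execution

/-! ### Random coefficients and the probabilistic lower bound -/

section Random

variable {F V : Type*} [Field F] [Finite F] [AddCommGroup V] [Module F V]
  [Finite I] [Finite O] [Finite Y] {Z}
  {b : I → V} {v : (O → Y → F) → I ⊕ O → V}

/-- The cut capacities drop below `m` when operation `o` is carried out with probability at most
`1 / q`, and never if `o` uses no random coefficients. -/
lemma card_mul_ncard_drop_le (hv : ∀ ω, Z.IsExecution b ω (v ω)) (T : Set (I ⊕ O)) (m : ℕ)
    {o : O} {S : Set O} (ho : o ∉ S)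
    (hS : ∀ o' ∈ S, Z.feeds (Sum.inr o') ⊆ known S) (hfeeds : Z.feeds (Sum.inr o) ⊆ known S) :
    Nat.card F * {ω | (∀ U, Disjoint U (known S) →
        m ≤ mixedCut Z.feeds T F (v ω) (known S) U) ∧
      ∃ U, Disjoint U (known (insert o S)) ∧
        mixedCut Z.feeds T F (v ω) (known (insert o S)) U < m}.ncard ≤
      if (Z.mix o).Nonempty then Nat.card (O → Y → F) else 0 := by
  classical
  set B := {ω | (∀ U, Disjoint U (known S) → m ≤ mixedCut Z.feeds T F (v ω) (known S) U) ∧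
      ∃ U, Disjoint U (known (insert o S)) ∧
        mixedCut Z.feeds T F (v ω) (known (insert o S)) U < m} with hBdef
  -- The known vectors, with `0` elsewhere. All choices below are functions of `r ω`, so they agree
  -- for coefficient choices that differ only at `o`.
  set r : (O → Y → F) → I ⊕ O → V := fun ω => (known S).indicator (v ω) with hr
  have hrv : ∀ ω, ∀ e ∈ known S, v ω e = r ω e := fun ω e he => by
    simp [hr, Set.indicator_of_mem he]
  have hrr : ∀ ω ω', (∀ o' ≠ o, ω o' = ω' o') → r ω = r ω' := by
    intro ω ω' h
    funext e
    by_cases he : e ∈ known S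
    · rw [← hrv ω e he, ← hrv ω' e he]
      exact (hv ω).congr (hv ω') hS
        (fun o' ho' => h o' (fun h' => ho (h' ▸ ho'))) e he
    · simp [hr, he]
  have hA : ∀ u : I ⊕ O → V, ∃ A : Submodule F V,
      (∀ U, Disjoint U (known S) → m ≤ mixedCut Z.feeds T F u (known S) U) →
      ∀ u' : I ⊕ O → V, (∀ e ∈ known S, u' e = u e) →
      (∃ U, Disjoint U (insert (Sum.inr o) (known S)) ∧
        mixedCut Z.feeds T F u' (insert (Sum.inr o) (known S)) U < m) →
      u' (Sum.inr o) ∈ A ∧ ∃ e ∈ Z.feeds (Sum.inr o), u e ∉ A := by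
    intro u
    by_cases h : ∀ U, Disjoint U (known S) → m ≤ mixedCut Z.feeds T F u (known S) U
    · obtain ⟨A, hA⟩ := exists_submodule_of_mixedCut_lt Z.feeds T F u (known S)
        (o := Sum.inr o) (fun h => ho (h o rfl)) hfeeds h
      exact ⟨A, fun _ => hA⟩
    · exact ⟨⊤, fun h' => absurd h' h⟩
  choose A hA using hA
  have hmemA : ∀ ω ∈ B, v ω (Sum.inr o) ∈ A (r ω) ∧
      ∃ y ∈ Z.mix o, Z.input (r ω) o y ∉ A (r ω) := by
    rintro ω ⟨h1, h2⟩
    rw [known_insert] at h2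
    obtain ⟨h3, e, ⟨y, hy, hye⟩, heA⟩ := hA (r ω)
      (fun U hU => (h1 U hU).trans_eq (mixedCut_congr _ _ _ (hrv ω) U)) (v ω) (hrv ω) h2
    refine ⟨h3, ?_⟩
    have hye' : Z.input (r ω) o y ∉ A (r ω) := by
      simpa [input, hye] using heA
    -- If every randomly weighted input lay in `A`, the input outside `A` would be the kept packet,
    -- and then the result would lie outside `A`, whatever the coefficients.
    by_contra! hcon
    have hyk : Z.keep o = some y := hy.resolve_right fun h => hye' (hcon y h)
    rw [(hv ω).2, result_congr hfeeds (hrv ω), hyk] at h3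
    exact hye' (((A (r ω)).add_mem_iff_left
      ((A (r ω)).sum_mem fun z hz => (A (r ω)).smul_mem _ (hcon z hz))).1 h3)
  split_ifs with hmix
  · have hy₀ : ∀ u : I ⊕ O → V, ∃ y : Y, (∃ y ∈ Z.mix o, Z.input u o y ∉ A u) →
        y ∈ Z.mix o ∧ Z.input u o y ∉ A u := by
      intro u
      by_cases h : ∃ y ∈ Z.mix o, Z.input u o y ∉ A u
      · obtain ⟨y, hy⟩ := h
        exact ⟨y, fun _ => hy⟩
      · exact ⟨hmix.choose, fun h' => absurd h' h⟩
    choose y₀ hy₀ using hy₀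
    refine card_mul_ncard_le o B (fun ω => y₀ (r ω)) (fun ω _ ω' _ h => by rw [hrr ω ω' h]) ?_
    intro ω hω ω' hω' h hy
    obtain ⟨h1, h2⟩ := hmemA ω hω
    obtain ⟨h1', -⟩ := hmemA ω' hω'
    obtain ⟨h3, h4⟩ := hy₀ _ h2
    rw [(hv ω').2, result_congr hfeeds (hrv ω'), ← hrr ω ω' h] at h1'
    rw [(hv ω).2, result_congr hfeeds (hrv ω)] at h1
    -- Both results lie in the same subspace, and their difference is the difference of the two
    -- coefficients at `y₀` times an input outside it.
    have h5 := (A (r ω)).sub_mem h1 h1'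
    rw [add_sub_add_left_eq_sub, ← Finset.sum_sub_distrib,
      Finset.sum_eq_single_of_mem _ h3 (fun y _ hne => by rw [hy y hne, sub_self]),
      ← sub_smul] at h5
    by_contra hne
    exact h4 (((A (r ω)).smul_mem_iff (sub_ne_zero.2 hne)).1 h5)
  · have : B = ∅ := by
      ext ω
      simp only [Set.mem_empty_iff_false, iff_false]
      intro hω
      obtain ⟨-, y, hy, -⟩ := hmemA ω hω
      exact hmix ⟨y, hy⟩
    simp [this]

/-- The union bound over the operations of `S`, taken in order of time: a bad event either was
already present before the last operation or is a drop caused by it. -/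
lemma card_mul_ncard_exists_mixedCut_lt_le (hv : ∀ ω, Z.IsExecution b ω (v ω)) (T : Set (I ⊕ O)) (m : ℕ)
    (hm : ∀ ω U, Disjoint U (known ∅) → m ≤ mixedCut Z.feeds T F (v ω) (known ∅) U)
    (S : Finset O) (hS : ∀ o ∈ S, Z.feeds (Sum.inr o) ⊆ known (S : Set O)) :
    Nat.card F * {ω | ∃ U, Disjoint U (known (S : Set O)) ∧
        mixedCut Z.feeds T F (v ω) (known (S : Set O)) U < m}.ncard ≤
      {o | o ∈ S ∧ (Z.mix o).Nonempty}.ncard * Nat.card (O → Y → F) := by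
  classical
  induction S using Finset.induction_on_max_value Z.time with
  | empty =>
    have : {ω | ∃ U, Disjoint U (known (∅ : Set O)) ∧
        mixedCut Z.feeds T F (v ω) (known (∅ : Set O)) U < m} = ∅ := by
      ext ω
      simpa using hm ω
    simp [this]
  | insert o S ho hmax ih =>
    -- The operation `o` is latest, so it feeds nothing in `insert o S`, and `S` alone stays closed
    -- under inputs.
    have hno : ∀ o' ∈ insert o S, Sum.inr o ∉ Z.feeds (Sum.inr o') := by
      rintro o' ho' ⟨y, -, hy⟩
      have h1 := Z.time_lt _ _ _ hy
      rcases Finset.mem_insert.1 ho' with rfl | h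
      · exact lt_irrefl _ h1
      · exact absurd (hmax o' h) (not_le.2 h1)
    have hS' : ∀ o' ∈ insert o S, Z.feeds (Sum.inr o') ⊆ known (S : Set O) := by
      intro o' ho' e he
      have := hS o' ho' he
      rw [Finset.coe_insert, known_insert] at this
      rcases this with rfl | h
      · exact absurd he (hno o' ho')
      · exact h
    have h1 := ih (fun o' ho' => hS' o' (Finset.mem_insert_of_mem ho'))
    have h2 := card_mul_ncard_drop_le hv T m (o := o) (S := (S : Set O)) (by simpa using ho)
      (fun o' ho' => hS' o' (Finset.mem_insert_of_mem ho')) (hS' o (Finset.mem_insert_self _ _))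
    rw [Finset.coe_insert]
    set B := {ω | ∃ U, Disjoint U (known (S : Set O)) ∧
        mixedCut Z.feeds T F (v ω) (known (S : Set O)) U < m}
    set B' := {ω | (∀ U, Disjoint U (known (S : Set O)) →
        m ≤ mixedCut Z.feeds T F (v ω) (known (S : Set O)) U) ∧
      ∃ U, Disjoint U (known (insert o (S : Set O))) ∧
        mixedCut Z.feeds T F (v ω) (known (insert o (S : Set O))) U < m}
    have h3 : {ω | ∃ U, Disjoint U (known (insert o (S : Set O))) ∧
        mixedCut Z.feeds T F (v ω) (known (insert o (S : Set O))) U < m} ⊆ B ∪ B' := by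
      intro ω hω
      by_cases h : ω ∈ B
      · exact Or.inl h
      · refine Or.inr ⟨?_, hω⟩
        intro U hU
        by_contra hlt
        exact h ⟨U, hU, not_le.1 hlt⟩
    have h4 := (Set.ncard_le_ncard h3 (Set.toFinite _)).trans (Set.ncard_union_le B B')
    have h5 : {o' | o' ∈ S ∧ (Z.mix o').Nonempty}.ncard * Nat.card (O → Y → F) +
        (if (Z.mix o).Nonempty then Nat.card (O → Y → F) else 0) ≤
        {o' | o' ∈ insert o S ∧ (Z.mix o').Nonempty}.ncard * Nat.card (O → Y → F) := by
      split_ifs with hmix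
      · have : {o' | o' ∈ insert o S ∧ (Z.mix o').Nonempty} =
            insert o {o' | o' ∈ S ∧ (Z.mix o').Nonempty} := by
          ext o'; simp only [Set.mem_ofPred_eq, Set.mem_insert_iff, Finset.mem_insert]; grind
        rw [this, Set.ncard_insert_of_notMem (by simp [ho]) (Set.toFinite _), add_mul, one_mul]
      · rw [add_zero]
        refine Nat.mul_le_mul_right _ (Set.ncard_le_ncard ?_ (Set.toFinite _))
        exact fun o' h => ⟨Finset.mem_insert_of_mem h.1, h.2⟩
    calc _ ≤ Nat.card F * (B.ncard + B'.ncard) := Nat.mul_le_mul_left _ h4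
      _ = Nat.card F * B.ncard + Nat.card F * B'.ncard := mul_add _ _ _
      _ ≤ _ := (Nat.add_le_add h1 h2).trans h5

/-- If all cuts have capacity at least `m`, then the rank at the sink is at least `m`, except with
probability at most the number of coding operations divided by `q`. -/
theorem card_mul_ncard_finrank_lt_le (hv : ∀ ω, Z.IsExecution b ω (v ω)) (T : Set (I ⊕ O)) (m : ℕ)
    (hb : LinearIndependent F b)
    (hm : ∀ U ⊆ Set.range Sum.inr, m ≤ (entering Z.feeds T U \ U).ncard) :
    Nat.card F * {ω | Module.finrank F (Submodule.span F (v ω '' T)) < m}.ncard ≤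
      {o | (Z.mix o).Nonempty}.ncard * Nat.card (O → Y → F) := by
  classical
  have := Fintype.ofFinite O
  -- Before any operation the known packets are the messages; by independence their rank is their
  -- number, so the mixed capacity is at least the ordinary one.
  have h0 : ∀ ω U, Disjoint U (known ∅) → m ≤ mixedCut Z.feeds T F (v ω) (known ∅) U := by
    intro ω U hU
    have hUr : U ⊆ Set.range Sum.inr := by
      rintro (i | o) he
      · exact absurd (by simp [known]) (Set.disjoint_left.1 hU he)
      · exact ⟨o, rfl⟩
    refine (hm U hUr).trans ?_
    unfold mixedCut
    set Q := entering Z.feeds T U with hQ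
    have h1 : Module.finrank F (Submodule.span F (v ω '' (Q ∩ known ∅))) =
        (Q ∩ known ∅).ncard := by
      have hli : LinearIndependent F (fun e : ↥(Q ∩ known ∅) => v ω e) := by
        have hlr : ∀ e : ↥(Q ∩ known ∅), ∃ i, e.1 = Sum.inl i := by
          rintro ⟨i | o, -, he⟩
          · exact ⟨i, rfl⟩
          · exact absurd (he o rfl) (Set.notMem_empty _)
        choose g hg using hlr
        have : (fun e : ↥(Q ∩ known ∅) => v ω e) = b ∘ g := by
          funext e
          simp only [Function.comp, hg e, (hv ω).1]
        rw [this]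
        refine hb.comp g fun e e' h => Subtype.ext ?_
        rw [hg, hg, h]
      have := Fintype.ofFinite ↥(Q ∩ known ∅)
      have h2 := finrank_span_eq_card hli
      rw [Set.image_eq_range, h2, ← Nat.card_eq_fintype_card, Nat.card_coe_set_eq]
    rw [h1]
    have h3 : Q \ U ⊆ (Q ∩ known ∅) ∪ (Q \ (known ∅ ∪ U)) := by
      intro e he
      simp only [Set.mem_union, Set.mem_inter_iff, Set.mem_sdiff] at he ⊢
      tauto
    exact (Set.ncard_le_ncard h3 (Set.toFinite _)).trans (Set.ncard_union_le _ _)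
  have h1 := card_mul_ncard_exists_mixedCut_lt_le hv T m h0 Finset.univ
    (fun o _ e _ o' _ => by simp)
  have h2 : {o | o ∈ Finset.univ ∧ (Z.mix o).Nonempty} = {o | (Z.mix o).Nonempty} := by simp
  rw [h2] at h1
  refine le_trans (Nat.mul_le_mul_left _ (Set.ncard_le_ncard ?_ (Set.toFinite _))) h1
  intro ω hω
  -- Once every packet is known, the empty cut has as mixed capacity exactly the rank at the sink.
  refine ⟨∅, Set.empty_disjoint _, ?_⟩
  have e1 : (known ((Finset.univ : Finset O) : Set O) : Set (I ⊕ O)) = Set.univ := by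
    ext e; simp [known]
  have e2 : entering Z.feeds T ∅ = T := by simp [entering]
  unfold mixedCut
  rw [e1, e2, Set.inter_univ, Set.univ_union, Set.sdiff_univ, Set.ncard_empty, add_zero]
  exact hω

end Random

end CodingScheme

namespace DirHypergraph

lemma minCut_le (H : DirHypergraph) {s x : H.Vtx} (W : Set H.Vtx) (hs : s ∈ W) (hx : x ∉ W) :
    H.minCut s x ≤ (H.cutEdges W).ncard :=
  Nat.sInf_le ⟨W, hs, hx, rfl⟩

lemma exists_ncard_eq_minCut (H : DirHypergraph) {s x : H.Vtx} (h : x ≠ s) :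
    ∃ W : Set H.Vtx, s ∈ W ∧ x ∉ W ∧ (H.cutEdges W).ncard = H.minCut s x :=
  Nat.sInf_mem (s := {c | ∃ W : Set H.Vtx, s ∈ W ∧ x ∉ W ∧ (H.cutEdges W).ncard = c})
    ⟨_, {s}, rfl, h, rfl⟩

end DirHypergraph

/-! ### The execution of a protocol as a coding scheme -/

namespace Schedule

variable {n k : ℕ} {G : Schedule n k}

lemma IsNext.left_unique {c c' x : G.Copy} (h : G.IsNext c x) (h' : G.IsNext c' x) : c = c' := by
  obtain ⟨h1, h2, h3⟩ := h
  obtain ⟨h1', h2', h3'⟩ := h'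
  refine Subtype.ext (Prod.ext (h1.trans h1'.symm) ?_)
  rcases lt_trichotomy c.1.2 c'.1.2 with h | h | h
  · linarith [h3 c' (h1'.trans h1.symm) h]
  · exact h
  · linarith [h3' c (h1.trans h1'.symm) h]

lemma IsNext.right_unique {c x x' : G.Copy} (h : G.IsNext c x) (h' : G.IsNext c x') : x = x' := by
  obtain ⟨h1, h2, h3⟩ := h
  obtain ⟨h1', h2', h3'⟩ := h'
  refine Subtype.ext (Prod.ext (h1.symm.trans h1') ?_)
  exact le_antisymm (h3 x' h1'.symm h2') (h3' x h1.symm h2)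

lemma exists_isNext {c x : G.Copy} (h : c.1.1 = x.1.1) (hlt : c.1.2 < x.1.2) :
    ∃ d, G.IsNext d x := by
  classical
  obtain ⟨d, hd, hmax⟩ := Finset.exists_max_image
    (Finset.univ.filter fun d : G.Copy => d.1.1 = x.1.1 ∧ d.1.2 < x.1.2) (fun d => d.1.2)
    ⟨c, by simp [h, hlt]⟩
  simp only [Finset.mem_filter, Finset.mem_univ, true_and] at hd hmax
  refine ⟨d, hd.1, hd.2, fun z hz hlt' => ?_⟩
  by_contra hcon
  exact absurd (hmax z ⟨hz.trans hd.1, not_le.1 hcon⟩) (not_le.2 hlt')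

namespace Protocol

variable (X : G.Protocol)

open Classical in
/-- The hyperedge that provides an input of a copy, if any. -/
noncomputable def inputEdge (x : G.Copy) : X.Input → Option (Fin k ⊕ X.Op) :=
  Sum.elim
    (fun j => if h : ∃ c, G.IsNext c x then some (Sum.inr (Sum.inl (h.choose, j))) else none)
    (fun a => if x.1 ∈ G.arr a then some (Sum.map id Sum.inr a) else none)

lemma inputEdge_inl_of_isNext {c x : G.Copy} (h : G.IsNext c x) (j : X.Slot) :
    X.inputEdge x (Sum.inl j) = some (Sum.inr (Sum.inl (c, j))) := by
  have h' : ∃ c, G.IsNext c x := ⟨c, h⟩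
  simp only [inputEdge, Sum.elim_inl, dif_pos h', h'.choose_spec.left_unique h]

lemma inputEdge_inl_eq_none {x : G.Copy} (h : ¬ ∃ c, G.IsNext c x) (j : X.Slot) :
    X.inputEdge x (Sum.inl j) = none := by
  simp only [inputEdge, Sum.elim_inl, dif_neg h]

lemma inputEdge_inr {x : G.Copy} {a : G.Ext} (h : x.1 ∈ G.arr a) :
    X.inputEdge x (Sum.inr a) = some (Sum.map id Sum.inr a) := by
  simp [inputEdge, h]

lemma inputEdge_eq_some {x : G.Copy} {y : X.Input} {e : Fin k ⊕ X.Op}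
    (h : X.inputEdge x y = some e) :
    (∃ c j, y = Sum.inl j ∧ G.IsNext c x ∧ e = Sum.inr (Sum.inl (c, j))) ∨
      ∃ a, y = Sum.inr a ∧ x.1 ∈ G.arr a ∧ e = Sum.map id Sum.inr a := by
  rcases y with j | a
  · by_cases hx : ∃ c, G.IsNext c x
    · obtain ⟨c, hc⟩ := hx
      rw [X.inputEdge_inl_of_isNext hc, Option.some_inj] at h
      exact Or.inl ⟨c, j, rfl, hc, h.symm⟩
    · rw [X.inputEdge_inl_eq_none hx] at h
      cases h
  · by_cases hx : x.1 ∈ G.arr a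
    · rw [X.inputEdge_inr hx, Option.some_inj] at h
      exact Or.inr ⟨a, rfl, hx, h.symm⟩
    · simp [inputEdge, hx] at h

/-- The operations of a protocol as a coding scheme. -/
noncomputable def scheme : CodingScheme (Fin k) X.Op X.Input where
  keep := X.keep
  mix := X.mix
  src o := X.inputEdge (X.loc o)
  time o := (X.loc o).1.2
  time_lt o y o' h := by
    rcases X.inputEdge_eq_some h with ⟨c, j, -, hc, he⟩ | ⟨a, -, ha, he⟩
    · cases he
      exact hc.2.1
    · rcases a with i | e
      · cases he
      · cases he
        exact G.delay_pos e _ ha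

variable {F : Type} [Field F] {l : ℕ}

/-- The packets that are carried by the hyperedges. -/
noncomputable def carried (msg : Fin k → Fin l → F) (ω : X.Coeffs F) :
    Fin k ⊕ X.Op → Packet F k l :=
  Sum.elim (fun i => (Pi.single i 1, msg i))
    (fun o => X.result ω o ((X.stateBefore ω msg (X.loc o).1.2).atHand (X.loc o).1))

/-- Replaces the fold over sorted event times by a recursion: the state before `t` arises from the
state before the last event time `t' < t` by one step at `t'`, since `t'` is the final entry of the
sorted list. -/
lemma stateBefore_induction (ω : X.Coeffs F) (msg : Fin k → Fin l → F)
    {p : ℝ → X.State F l → Prop}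
    (init : ∀ t, (∀ c : G.Copy, t ≤ c.1.2) → p t (X.init msg))
    (step : ∀ t' t, t' < t → (∀ c : G.Copy, c.1.2 < t → c.1.2 ≤ t') →
      p t' (X.stateBefore ω msg t') → p t (X.step ω (X.stateBefore ω msg t') t'))
    (t : ℝ) : p t (X.stateBefore ω msg t) := by
  classical
  set τ := G.copies.image Prod.snd with hτ
  have hcopy : ∀ c : G.Copy, c.1.2 ∈ τ := fun c => Finset.mem_image_of_mem _ c.2
  induction hN : (τ.filter (· < t)).card using Nat.strong_induction_on generalizing t with
  | _ N ih =>
    rcases (τ.filter (· < t)).eq_empty_or_nonempty with he | hne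
    · have : X.stateBefore ω msg t = X.init msg := by
        unfold stateBefore
        rw [← hτ, he]
        simp
      rw [this]
      refine init t fun c => ?_
      by_contra hlt
      have : c.1.2 ∈ τ.filter (· < t) := Finset.mem_filter.2 ⟨hcopy c, not_le.1 hlt⟩
      rw [he] at this
      simp at this
    · set t' := (τ.filter (· < t)).max' hne with ht'
      have hmem := Finset.mem_filter.1 ((τ.filter (· < t)).max'_mem hne)
      have hle : ∀ s ∈ τ, s < t → s ≤ t' := fun s hs hlt =>
        Finset.le_max' _ _ (Finset.mem_filter.2 ⟨hs, hlt⟩)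
      have hins : τ.filter (· < t) = insert t' (τ.filter (· < t')) := by
        ext s
        simp only [Finset.mem_filter, Finset.mem_insert]
        constructor
        · rintro ⟨hs, hlt⟩
          rcases (hle s hs hlt).eq_or_lt with h | h
          · exact Or.inl h
          · exact Or.inr ⟨hs, h⟩
        · rintro (rfl | ⟨hs, hlt⟩)
          · exact hmem
          · exact ⟨hs, hlt.trans hmem.2⟩
      have hnot : t' ∉ τ.filter (· < t') := by simp
      have hsort : (τ.filter (· < t)).sort (· ≤ ·) = (τ.filter (· < t')).sort (· ≤ ·) ++ [t'] := by
        refine List.Perm.eq_of_pairwise (le := (· ≤ ·)) (fun a b _ _ => le_antisymm)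
          (Finset.pairwise_sort _ _) ?_ ?_
        · rw [List.pairwise_append]
          refine ⟨Finset.pairwise_sort _ _, List.pairwise_singleton _ _, ?_⟩
          intro a ha b hb
          rw [Finset.mem_sort, Finset.mem_filter] at ha
          rw [List.mem_singleton.1 hb]
          exact ha.2.le
        · refine (List.perm_ext_iff_of_nodup (Finset.sort_nodup _ _) ?_).2 ?_
          · rw [List.nodup_append]
            refine ⟨Finset.sort_nodup _ _, List.nodup_singleton _, ?_⟩
            intro a ha b hb
            rw [Finset.mem_sort, Finset.mem_filter] at ha
            rw [List.mem_singleton.1 hb]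
            exact ha.2.ne
          · intro a
            rw [Finset.mem_sort, hins]
            simp [or_comm]
      have hstate : X.stateBefore ω msg t = X.step ω (X.stateBefore ω msg t') t' := by
        unfold stateBefore
        rw [← hτ, hsort, List.foldl_append]
        rfl
      rw [hstate]
      refine step t' t hmem.2 (fun c hc => hle _ (hcopy c) hc) (ih _ ?_ t' rfl)
      rw [← hN, hins, Finset.card_insert_of_notMem hnot]
      exact Nat.lt_succ_self _

lemma stateBefore_ext_inl (ω : X.Coeffs F) (msg : Fin k → Fin l → F) (i : Fin k) (t : ℝ) :
    (X.stateBefore ω msg t).ext (Sum.inl i) = X.carried msg ω (Sum.inl i) := by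
  induction t using X.stateBefore_induction ω msg with
  | init t h => rfl
  | step t' t hlt h ih => exact ih

lemma stateBefore_ext_inr (ω : X.Coeffs F) (msg : Fin k → Fin l → F) (e : Fin G.numTx) (t : ℝ)
    (ht : G.sendTime e < t) :
    (X.stateBefore ω msg t).ext (Sum.inr e) = X.carried msg ω (Sum.inr (Sum.inr e)) := by
  revert ht
  induction t using X.stateBefore_induction ω msg with
  | init t h =>
    intro ht
    exact absurd (h (G.originCopy e)) (not_le.2 ht)
  | step t' t hlt h ih =>
    intro ht
    simp only [step, Sum.elim_inr]
    split_ifs with he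
    · subst he
      rfl
    · exact ih (lt_of_le_of_ne (h (G.originCopy e) ht) he)

lemma stateBefore_mem_eq_zero (ω : X.Coeffs F) (msg : Fin k → Fin l → F) (v : Fin n) (j : X.Slot)
    (t : ℝ) (ht : ∀ c : G.Copy, c.1.1 = v → t ≤ c.1.2) :
    (X.stateBefore ω msg t).mem v j = 0 := by
  revert ht
  induction t using X.stateBefore_induction ω msg with
  | init t h => intro _; rfl
  | step t' t hlt h ih =>
    intro ht
    have hv : (v, t') ∉ G.copies := fun hc => absurd (ht ⟨(v, t'), hc⟩ rfl) (not_le.2 hlt)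
    simp only [step, dif_neg hv]
    exact ih fun c hc => hlt.le.trans (ht c hc)

lemma stateBefore_mem (ω : X.Coeffs F) (msg : Fin k → Fin l → F) (c : G.Copy) (j : X.Slot)
    (t : ℝ) (hc : c.1.2 < t) (ht : ∀ d : G.Copy, d.1.1 = c.1.1 → d.1.2 < t → d.1.2 ≤ c.1.2) :
    (X.stateBefore ω msg t).mem c.1.1 j = X.carried msg ω (Sum.inr (Sum.inl (c, j))) := by
  revert hc ht
  induction t using X.stateBefore_induction ω msg with
  | init t h => exact fun hc => absurd (h c) (not_le.2 hc)
  | step t' t hlt h ih =>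
    intro hc ht
    have hct := h c hc
    by_cases hv : (c.1.1, t') ∈ G.copies
    · have heq : c = ⟨(c.1.1, t'), hv⟩ :=
        Subtype.ext (Prod.ext rfl (le_antisymm hct (ht ⟨(c.1.1, t'), hv⟩ rfl hlt)))
      have h2 : c.1.2 = t' := congrArg (fun d : G.Copy => d.1.2) heq
      simp only [step, dif_pos hv]
      subst h2
      rfl
    · simp only [step, dif_neg hv]
      refine ih (lt_of_le_of_ne hct ?_) fun d hd hdt => ht d hd (hdt.trans hlt)
      intro h'
      exact hv (by rw [← h']; exact c.2)

/-- This turns the run in time into a static coding scheme. A memory cell was last written at the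
preceding copy of the node, and an arriving transmission was sent strictly earlier because delays
are positive. -/
lemma stateBefore_atHand (ω : X.Coeffs F) (msg : Fin k → Fin l → F) (x : G.Copy) (y : X.Input) :
    (X.stateBefore ω msg x.1.2).atHand x.1 y = (X.inputEdge x y).elim 0 (X.carried msg ω) := by
  rcases y with j | a
  · simp only [State.atHand, Sum.elim_inl]
    by_cases hx : ∃ c, G.IsNext c x
    · obtain ⟨c, hc⟩ := hx
      rw [X.inputEdge_inl_of_isNext hc, ← hc.1]
      refine X.stateBefore_mem ω msg c j _ hc.2.1 fun d hd hdx => ?_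
      by_contra hcd
      exact absurd (hc.2.2 d hd (not_le.1 hcd)) (not_le.2 hdx)
    · rw [X.inputEdge_inl_eq_none hx]
      refine X.stateBefore_mem_eq_zero ω msg _ j _ fun c hc => ?_
      by_contra hcx
      exact hx (exists_isNext hc (not_le.1 hcx))
  · simp only [State.atHand, Sum.elim_inr]
    by_cases hx : x.1 ∈ G.arr a
    · rw [if_pos hx, X.inputEdge_inr hx]
      rcases a with i | e
      · exact X.stateBefore_ext_inl ω msg i _
      · exact X.stateBefore_ext_inr ω msg e _ (G.delay_pos e _ hx)
    · simp [inputEdge, hx]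

lemma isExecution_carried (msg : Fin k → Fin l → F) (ω : X.Coeffs F) :
    X.scheme.IsExecution (fun i => ((Pi.single i 1, msg i) : Packet F k l)) ω
      (X.carried msg ω) := by
  refine ⟨fun i => rfl, fun o => ?_⟩
  have h : (X.stateBefore ω msg (X.loc o).1.2).atHand (X.loc o).1 =
      X.scheme.input (X.carried msg ω) o :=
    funext fun y => X.stateBefore_atHand ω msg (X.loc o) y
  change X.result ω o _ = _
  rw [h]
  rfl

/-- The hyperedges whose packets are at hand at a copy. -/
def atHandEdges (x : G.Copy) : Set (Fin k ⊕ X.Op) := {e | ∃ y, X.inputEdge x y = some e}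

lemma information_eq (msg : Fin k → Fin l → F) (ω : X.Coeffs F) (x : G.Copy) :
    X.information ω msg x =
      Module.finrank F (Submodule.span F (X.carried msg ω '' X.atHandEdges x)) := by
  have h : Submodule.span F (Set.range ((X.stateBefore ω msg x.1.2).atHand x.1)) =
      Submodule.span F (X.carried msg ω '' X.atHandEdges x) := by
    apply le_antisymm
    · rw [Submodule.span_le]
      rintro _ ⟨y, rfl⟩
      rw [X.stateBefore_atHand]
      cases hy : X.inputEdge x y with
      | none => exact Submodule.zero_mem _
      | some e => exact Submodule.subset_span ⟨e, ⟨y, hy⟩, rfl⟩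
    · rw [Submodule.span_le]
      rintro _ ⟨e, ⟨y, hy⟩, rfl⟩
      refine Submodule.subset_span ⟨y, ?_⟩
      rw [X.stateBefore_atHand, hy]
      rfl
  unfold information
  rw [h]

/-- The coefficient parts are the unit vectors, so the payloads play no role. -/
lemma linearIndependent_messages (msg : Fin k → Fin l → F) :
    LinearIndependent F (fun i => ((Pi.single i 1, msg i) : Packet F k l)) := by
  refine LinearIndependent.of_comp (LinearMap.fst F (Fin k → F) (Fin l → F)) ?_
  exact Pi.linearIndependent_single_one (Fin k) F

/-! ### The min-cut of the transform -/

/-- The source or operation that forms the packet of a hyperedge of the transform. -/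
noncomputable def edgeOrigin : X.transform.Edge → Fin k ⊕ X.Op
  | Sum.inl a => Sum.map id Sum.inr a
  | Sum.inr (p, j) => Sum.inr (Sum.inl (p.1.1, j))

/-- The next copy of a node is unique, so a memory edge is determined by the operation that fills
it. Cuts of the transform can thus be counted by origins. -/
lemma edgeOrigin_injective : Function.Injective X.edgeOrigin := by
  rintro ((i | e) | ⟨⟨⟨p, p'⟩, hp⟩, j⟩) ((i' | e') | ⟨⟨⟨q, q'⟩, hq⟩, j'⟩) h <;>
    simp only [edgeOrigin, Sum.map_inl, Sum.map_inr, Sum.inl.injEq, Sum.inr.injEq, id,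
      Prod.mk.injEq, reduceCtorEq] at h
  · rw [h]
  · rw [h]
  · obtain ⟨rfl, rfl⟩ := h
    obtain rfl := IsNext.right_unique hp hq
    rfl

instance : Finite X.transform.Edge := by
  unfold transform
  infer_instance

/-- Inputs of an operation and of the sink correspond to heads of hyperedges of the transform. -/
lemma exists_edge_of_inputEdge {x : G.Copy} {y : X.Input} {e : Fin k ⊕ X.Op}
    (h : X.inputEdge x y = some e) :
    ∃ a : X.transform.Edge, X.edgeOrigin a = e ∧ .copy x ∈ X.transform.heads a ∧
      ∀ o : X.Op, X.loc o = x → y ∈ X.inputs o → .op o ∈ X.transform.heads a := by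
  rcases X.inputEdge_eq_some h with ⟨c, j, rfl, hc, rfl⟩ | ⟨a, rfl, ha, rfl⟩
  · exact ⟨Sum.inr (⟨(c, x), hc⟩, j), rfl, Or.inl rfl, fun o ho hy => Or.inr ⟨o, rfl, ho, hy⟩⟩
  · exact ⟨Sum.inl a, rfl, Or.inl ⟨x, rfl, ha⟩, fun o ho hy => Or.inr ⟨o, rfl, ho ▸ ha, hy⟩⟩

lemma mem_atHandEdges_of_mem_heads {x : G.Copy} {a : X.transform.Edge}
    (h : .copy x ∈ X.transform.heads a) : X.edgeOrigin a ∈ X.atHandEdges x := by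
  rcases a with a | ⟨⟨⟨c, d⟩, hcd⟩, j⟩
  · rcases h with ⟨c, hc, ha⟩ | ⟨o, ho, -⟩
    · cases hc
      exact ⟨Sum.inr a, X.inputEdge_inr ha⟩
    · cases ho
  · rcases h with h | ⟨o, ho, -⟩
    · cases h
      exact ⟨Sum.inl j, X.inputEdge_inl_of_isNext hcd j⟩
    · cases ho

lemma mem_feeds_of_mem_heads {o : X.Op} {a : X.transform.Edge}
    (h : .op o ∈ X.transform.heads a) : X.edgeOrigin a ∈ X.scheme.feeds (Sum.inr o) := by
  rcases a with a | ⟨⟨⟨c, d⟩, hcd⟩, j⟩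
  · rcases h with ⟨c, hc, ha⟩ | ⟨o', ho, ha, hy⟩
    · cases hc
    · cases ho
      exact ⟨Sum.inr a, hy, X.inputEdge_inr ha⟩
  · rcases h with h | ⟨o', ho, hl, hy⟩
    · cases h
    · cases ho
      cases hl
      exact ⟨Sum.inl j, hy, X.inputEdge_inl_of_isNext hcd j⟩

lemma minCut_le_ncard_entering (x : G.Copy) (U : Set (Fin k ⊕ X.Op))
    (hU : U ⊆ Set.range Sum.inr) :
    X.transform.minCut .source (.copy x) ≤
      (entering X.scheme.feeds (X.atHandEdges x) U \ U).ncard := by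
  -- Copies have no outgoing hyperedges in the transform, so all of them except the sink can be put
  -- on the source side at no cost.
  set W : Set X.TVertex := {z | z ≠ .copy x ∧ ∀ o, z = .op o → Sum.inr o ∉ U} with hW
  refine (X.transform.minCut_le W ?_ ?_).trans ?_
  · exact ⟨by simp, by simp⟩
  · exact fun h => h.1 rfl
  · rw [← Set.ncard_image_of_injective _ X.edgeOrigin_injective]
    refine Set.ncard_le_ncard ?_ (Set.toFinite _)
    rintro _ ⟨a, ⟨ht, z, hz, hzW⟩, rfl⟩
    refine ⟨(mem_entering _ _).2 ?_, ?_⟩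
    · have hzW' : ¬ (z ≠ .copy x ∧ ∀ o, z = .op o → Sum.inr o ∉ U) := hzW
      simp only [not_and_or, not_not, not_forall] at hzW'
      rcases hzW' with rfl | ⟨o, rfl, ho⟩
      · exact Or.inl (X.mem_atHandEdges_of_mem_heads hz)
      · exact Or.inr ⟨_, ho, X.mem_feeds_of_mem_heads hz⟩
    · intro h
      rcases a with (i | e) | ⟨p, j⟩
      · obtain ⟨_, h'⟩ := hU h
        cases h'
      · exact ht.2 _ rfl h
      · exact ht.2 _ rfl h

lemma exists_ncard_entering_le_minCut (x : G.Copy) :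
    ∃ U : Set (Fin k ⊕ X.Op), U ⊆ Set.range Sum.inr ∧
      (entering X.scheme.feeds (X.atHandEdges x) U \ U).ncard ≤
        X.transform.minCut .source (.copy x) := by
  obtain ⟨W, hs, hx, hcard⟩ := X.transform.exists_ncard_eq_minCut (s := .source) (x := .copy x)
    (fun h => by cases h)
  -- Only the operations on the sink side matter; other copies there can only add crossing
  -- hyperedges.
  refine ⟨{e | ∃ o, e = Sum.inr o ∧ TVertex.op o ∉ W}, ?_, ?_⟩
  · rintro _ ⟨o, rfl, -⟩
    exact ⟨o, rfl⟩
  · refine le_trans ?_ hcard.le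
    rw [← Set.ncard_image_of_injective _ X.edgeOrigin_injective]
    refine Set.ncard_le_ncard ?_ (Set.toFinite _)
    rintro e ⟨he, heU⟩
    have : ∃ a, X.edgeOrigin a = e ∧ ∃ z ∈ X.transform.heads a, z ∉ W := by
      rcases (mem_entering _ _).1 he with ⟨y, hy⟩ | ⟨_, ⟨o, rfl, ho⟩, y, hyo, hy⟩
      · obtain ⟨a, ha, hc, -⟩ := X.exists_edge_of_inputEdge hy
        exact ⟨a, ha, _, hc, hx⟩
      · obtain ⟨a, ha, -, hop⟩ := X.exists_edge_of_inputEdge hy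
        exact ⟨a, ha, _, hop o rfl hyo, ho⟩
    obtain ⟨a, rfl, hz⟩ := this
    refine ⟨a, ⟨?_, hz⟩, rfl⟩
    rcases a with (i | e) | ⟨p, j⟩
    · exact hs
    · by_contra h
      exact heU ⟨_, rfl, h⟩
    · by_contra h
      exact heU ⟨_, rfl, h⟩

lemma information_le_minCut (msg : Fin k → Fin l → F) (ω : X.Coeffs F) (x : G.Copy) :
    X.information ω msg x ≤ X.transform.minCut .source (.copy x) := by
  obtain ⟨U, hU, hle⟩ := X.exists_ncard_entering_le_minCut x
  rw [X.information_eq]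
  exact ((X.isExecution_carried msg ω).finrank_le _ U hU).trans hle

/-- The information falls short of the min-cut with probability at most the number of coding
operations divided by `q`. -/
theorem one_sub_le_prob [Fintype F] (msg : Fin k → Fin l → F) (x : G.Copy) :
    1 - (X.numCoding : ℝ) / Fintype.card F ≤ X.prob {ω : X.Coeffs F |
      X.information ω msg x = X.transform.minCut .source (.copy x)} := by
  set m := X.transform.minCut .source (.copy x) with hm
  have h1 := CodingScheme.card_mul_ncard_finrank_lt_le (fun ω => X.isExecution_carried msg ω)
    (X.atHandEdges x) m (linearIndependent_messages msg) (X.minCut_le_ncard_entering x)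
  have h2 : {ω : X.Coeffs F | Module.finrank F
      (Submodule.span F (X.carried msg ω '' X.atHandEdges x)) < m} =
      {ω : X.Coeffs F | X.information ω msg x = m}ᶜ := by
    ext ω
    have := X.information_le_minCut msg ω x
    simp only [Set.mem_ofPred_eq, Set.mem_compl_iff, ← X.information_eq]
    omega
  rw [h2, Nat.card_eq_fintype_card] at h1
  have h3 := Set.ncard_add_ncard_compl {ω : X.Coeffs F | X.information ω msg x = m}
  have hq : (0 : ℝ) < Fintype.card F := by exact_mod_cast Fintype.card_pos
  have hN : (0 : ℝ) < Nat.card (X.Coeffs F) := by exact_mod_cast Nat.card_pos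
  have h1' : (Fintype.card F : ℝ) * ({ω : X.Coeffs F | X.information ω msg x = m}ᶜ.ncard : ℝ) ≤
      X.numCoding * Nat.card (X.Coeffs F) := by exact_mod_cast h1
  have h3' : ({ω : X.Coeffs F | X.information ω msg x = m}.ncard : ℝ) +
      ({ω : X.Coeffs F | X.information ω msg x = m}ᶜ.ncard : ℝ) = Nat.card (X.Coeffs F) := by
    exact_mod_cast h3
  unfold prob
  rw [le_div_iff₀ hN, sub_mul, one_mul, div_mul_eq_mul_div, sub_le_comm, le_div_iff₀ hq]
  rw [← h3'] at h1' ⊢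
  linarith

end Protocol

end Schedule

namespace Schedule

variable {n k : ℕ} (G : Schedule n k)

/-! ### The transforms of PNC, the recombinator and the accumulator -/

lemma pnc_store_inputs {c : G.Copy} {b : G.Ext} {y : G.Ext ⊕ G.Ext}
    (h : y ∈ G.pnc.inputs (Sum.inl (c, b))) : Sum.elim id id y = b := by
  have h' : (if c.1 ∈ G.arr b then some (Sum.inr b : G.Ext ⊕ G.Ext) else some (Sum.inl b)) =
      some y := h.resolve_right (Finset.notMem_empty _)
  split_ifs at h' <;> rw [← Option.some_inj.1 h'] <;> rfl

lemma pnc_transform_minCut_le (x : G.Copy) :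
    G.pnc.transform.minCut .source (.copy x) ≤ G.pncTransform.minCut none (some x) := by
  obtain ⟨W, hs, hx, hcard⟩ := G.pncTransform.exists_ncard_eq_minCut (s := none) (x := some x)
    (fun h => by cases h)
  rw [← hcard]
  -- A storing operation for `a` is on the source side only if `a` is uncut, starts there and has
  -- already arrived at the node. Then no memory edge crosses: cells of cut or not yet arrived
  -- packets start on the sink side, and the others only reach copies covered by the memory closure.
  set W' : Set G.pnc.TVertex := {z | match z with
    | .source => True
    | .copy c => some c ∈ W
    | .op (Sum.inr e) => some (G.originCopy e) ∈ W
    | .op (Sum.inl (c, a)) => a ∉ G.pncTransform.cutEdges W ∧ G.pncTransform.tail a ∈ W ∧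
        ∃ d : G.Copy, d.1.1 = c.1.1 ∧ d.1.2 ≤ c.1.2 ∧ d.1 ∈ G.arr a} with hW'
  have hfin : Finite G.pncTransform.Edge := inferInstanceAs (Finite G.Ext)
  have hhead : ∀ (a : G.Ext) (c d : G.Copy), a ∉ G.pncTransform.cutEdges W →
      G.pncTransform.tail a ∈ W → c.1 ∈ G.arr a → c.1.1 = d.1.1 → c.1.2 ≤ d.1.2 → some d ∈ W := by
    intro a c d ha ht hc h1 h2
    by_contra hd
    exact ha ⟨ht, some d, ⟨c, d, rfl, ⟨c, rfl, hc⟩, h1, h2⟩, hd⟩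
  refine (G.pnc.transform.minCut_le (s := .source) (x := .copy x) W' trivial hx).trans ?_
  have hsub : G.pnc.transform.cutEdges W' ⊆ Sum.inl '' G.pncTransform.cutEdges W := by
    rintro (a | ⟨⟨⟨p, p'⟩, hp⟩, a⟩) ⟨ht, z, hz, hzW⟩
    · refine ⟨a, ?_, rfl⟩
      by_contra ha
      have ht' : G.pncTransform.tail a ∈ W := by
        rcases a with i | e
        · exact hs
        · exact ht
      rcases hz with ⟨c, rfl, hc⟩ | ⟨o, rfl, ho, hin⟩
      · exact hzW (hhead a c c ha ht' hc rfl le_rfl)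
      · rcases o with ⟨c, b⟩ | e
        · have hab : a = b := G.pnc_store_inputs (y := Sum.inr a) hin
          subst hab
          exact hzW ⟨ha, ht', c, rfl, le_rfl, ho⟩
        · exact hzW (hhead a (G.originCopy e) (G.originCopy e) ha ht' ho rfl le_rfl)
    · exfalso
      obtain ⟨ha, ht', d, hd1, hd2, hda⟩ := ht
      have hd1' : d.1.1 = p'.1.1 := hd1.trans hp.1
      have hd2' : d.1.2 ≤ p'.1.2 := hd2.trans hp.2.1.le
      have hp' := hhead a d p' ha ht' hda hd1' hd2'
      rcases hz with rfl | ⟨o, rfl, ho, hin⟩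
      · exact hzW hp'
      · rcases o with ⟨c, b⟩ | e
        · have hab : a = b := G.pnc_store_inputs (y := Sum.inl a) hin
          subst hab
          have hc : c = p' := ho
          subst hc
          exact hzW ⟨ha, ht', d, hd1', hd2', hda⟩
        · have hc : G.originCopy e = p' := ho
          exact hzW (show some (G.originCopy e) ∈ W from hc ▸ hp')
  refine (Set.ncard_le_ncard hsub (Set.toFinite _)).trans (Set.ncard_image_le (Set.toFinite _))

lemma le_pnc_transform_minCut (x : G.Copy) :
    G.pncTransform.minCut none (some x) ≤ G.pnc.transform.minCut .source (.copy x) := by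
  obtain ⟨W', hs, hx, hcard⟩ := G.pnc.transform.exists_ncard_eq_minCut (s := .source)
    (x := .copy x) (fun h => by cases h)
  rw [← hcard]
  -- A copy is on the source side when its own vertex and all sending operations there are; the
  -- supersource qualifies vacuously.
  set W : Set (Option G.Copy) := {z | ∀ c, z = some c →
    .copy c ∈ W' ∧ ∀ e, G.originCopy e = c → .op (Sum.inr e) ∈ W'} with hW
  refine (G.pncTransform.minCut_le W (fun c h => by cases h) (fun h => hx (h x rfl).1)).trans ?_
  -- The map collapses the transmission or message `a` and all memory edges of its cell to `a`. If
  -- `a` is cut in the closure, one of these hyperedges must be cut.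
  have hsub : G.pncTransform.cutEdges W ⊆
      (fun a : G.pnc.transform.Edge => (Sum.elim id Prod.snd a : G.Ext)) ''
        G.pnc.transform.cutEdges W' := by
    rintro a ⟨ht, _, ⟨c, d, rfl, ⟨c', hc', hca⟩, h1, h2⟩, hdW⟩
    cases hc'
    by_contra hcon
    have hnot : ∀ b : G.pnc.transform.Edge, (Sum.elim id Prod.snd b : G.Ext) = a →
        G.pnc.transform.tail b ∈ W' → ∀ z ∈ G.pnc.transform.heads b, z ∈ W' := by
      intro b hb hbt z hz
      by_contra hzW
      exact hcon ⟨b, ⟨hbt, z, hz, hzW⟩, hb⟩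
    have hta : G.pnc.transform.tail (Sum.inl a) ∈ W' := by
      rcases a with i | e
      · exact hs
      · exact (ht _ rfl).2 e rfl
    -- If none of them is cut, the source side propagates along the copies of the node from the
    -- arrival at `c`. At each copy the cell is refilled by a renewed arrival of `a` or from the
    -- preceding copy.
    have key : ∀ d : G.Copy, c.1.1 = d.1.1 → c.1.2 ≤ d.1.2 →
        .copy d ∈ W' ∧ (∀ e, G.originCopy e = d → .op (Sum.inr e) ∈ W') ∧
          .op (Sum.inl (d, a)) ∈ W' := by
      intro d
      induction d using Finite.induction_of_real (fun d : G.Copy => d.1.2) with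
      | h d ih =>
        intro h1 h2
        by_cases hda : d.1 ∈ G.arr a
        · have h := hnot (Sum.inl a) rfl hta
          refine ⟨h _ (Or.inl ⟨d, rfl, hda⟩), fun e he => h _ (Or.inr ⟨_, rfl, ?_, ?_⟩),
            h _ (Or.inr ⟨_, rfl, hda, Or.inl ?_⟩)⟩
          · exact (congrArg (fun c : G.Copy => c.1 ∈ G.arr a) he).mpr hda
          · exact Or.inr (Finset.mem_univ _)
          · simp [pnc, hda]
        · have hlt : c.1.2 < d.1.2 := lt_of_le_of_ne h2 fun h =>
            hda ((Prod.ext h1 h : c.1 = d.1) ▸ hca)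
          obtain ⟨d', hd'⟩ := exists_isNext h1 hlt
          have hcd' : c.1.2 ≤ d'.1.2 := by
            by_contra hcd
            exact absurd (hd'.2.2 c (h1.trans hd'.1.symm) (not_le.1 hcd)) (not_le.2 hlt)
          have h := hnot (Sum.inr (⟨(d', d), hd'⟩, a)) rfl
            (ih d' hd'.2.1 (h1.trans hd'.1.symm) hcd').2.2
          refine ⟨h _ (Or.inl rfl), fun e he => h _ (Or.inr ⟨_, rfl, he, ?_⟩),
            h _ (Or.inr ⟨_, rfl, rfl, Or.inl ?_⟩)⟩
          · exact Or.inr (Finset.mem_univ _)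
          · simp [pnc, hda]
    refine hdW fun d' hd' => ?_
    cases hd'
    exact ⟨(key d h1 h2).1, (key d h1 h2).2.1⟩
  exact (Set.ncard_le_ncard hsub ((Set.toFinite _).image _)).trans
    (Set.ncard_image_le (Set.toFinite _))

lemma pnc_minCut_eq (x : G.Copy) :
    G.pnc.transform.minCut .source (.copy x) = G.pncTransform.minCut none (some x) :=
  le_antisymm (G.pnc_transform_minCut_le x) (G.le_pnc_transform_minCut x)

/-- Every operation at a copy uses all packets at hand there, so its vertex is entered by the same
hyperedges as the copy. Merging the copy with its operations gives the simplified transform: in one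
direction a cut is pulled back, in the other a merged vertex goes to the sink side as soon as one of
its parts does. -/
lemma recombinator_minCut_eq (μ : ℕ) (x : G.Copy) :
    (G.recombinator μ).transform.minCut .source (.copy x) =
      (G.recombinatorTransform μ).minCut none (some x) := by
  have hfin : Finite (G.recombinatorTransform μ).Edge :=
    inferInstanceAs (Finite (G.Ext ⊕ (G.MemStep × Fin μ)))
  have hin : ∀ o y, y ∈ (G.recombinator μ).inputs o := fun o y => Or.inr (Finset.mem_univ _)
  apply le_antisymm
  · obtain ⟨W, hs, hx, hcard⟩ := (G.recombinatorTransform μ).exists_ncard_eq_minCut (s := none)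
      (x := some x) (fun h => by cases h)
    rw [← hcard]
    set W' : Set (G.recombinator μ).TVertex := {z | match z with
      | .source => True
      | .copy c => some c ∈ W
      | .op o => some ((G.recombinator μ).loc o) ∈ W} with hW'
    refine ((G.recombinator μ).transform.minCut_le (s := .source) (x := .copy x) W' trivial hx).trans ?_
    refine Set.ncard_le_ncard (t := (G.recombinatorTransform μ).cutEdges W) ?_ (Set.toFinite _)
    rintro (a | ⟨⟨⟨p, p'⟩, hp⟩, j⟩) ⟨ht, z, hz, hzW⟩
    · have ht' : (G.recombinatorTransform μ).tail (Sum.inl a) ∈ W := by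
        rcases a with i | e
        · exact hs
        · exact ht
      rcases hz with ⟨c, rfl, hc⟩ | ⟨o, rfl, ho, -⟩
      · exact ⟨ht', some c, ⟨c, rfl, hc⟩, hzW⟩
      · exact ⟨ht', some _, ⟨_, rfl, ho⟩, hzW⟩
    · rcases hz with rfl | ⟨o, rfl, rfl, -⟩
      · exact ⟨ht, some p', rfl, hzW⟩
      · exact ⟨ht, some _, rfl, hzW⟩
  · obtain ⟨W', hs, hx, hcard⟩ := (G.recombinator μ).transform.exists_ncard_eq_minCut
      (s := .source) (x := .copy x) (fun h => by cases h)
    rw [← hcard]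
    set W : Set (Option G.Copy) := {z | ∀ c, z = some c →
      .copy c ∈ W' ∧ ∀ o, (G.recombinator μ).loc o = c → .op o ∈ W'} with hW
    refine ((G.recombinatorTransform μ).minCut_le W (fun c h => by cases h)
      (fun h => hx (h x rfl).1)).trans ?_
    refine Set.ncard_le_ncard (t := (G.recombinator μ).transform.cutEdges W') ?_ (Set.toFinite _)
    rintro (a | ⟨⟨⟨p, p'⟩, hp⟩, j⟩) ⟨ht, z, hz, hzW⟩
    · have ht' : (G.recombinator μ).transform.tail (Sum.inl a) ∈ W' := by
        rcases a with i | e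
        · exact hs
        · exact (ht _ rfl).2 (Sum.inr e) rfl
      obtain ⟨c, rfl, hc⟩ := hz
      by_contra hcon
      refine hzW fun c' hc' => ?_
      cases hc'
      refine ⟨?_, fun o ho => ?_⟩ <;> by_contra h
      · exact hcon ⟨ht', _, Or.inl ⟨c, rfl, hc⟩, h⟩
      · exact hcon ⟨ht', _, Or.inr ⟨o, rfl, ho ▸ hc, hin _ _⟩, h⟩
    · have ht' : .op (Sum.inl (p, j)) ∈ W' := (ht p rfl).2 (Sum.inl (p, j)) rfl
      cases hz
      by_contra hcon
      refine hzW fun c' hc' => ?_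
      cases hc'
      refine ⟨?_, fun o ho => ?_⟩ <;> by_contra h
      · exact hcon ⟨ht', _, Or.inl rfl, h⟩
      · exact hcon ⟨ht', _, Or.inr ⟨o, rfl, ho, hin _ _⟩, h⟩

/-- The update of a cell becomes a memory vertex, while sending operations use all packets at hand
and merge with their copy. A cell is fed by its own old content and by arrivals only (`hcell`,
`harr`), which is why memory vertices stay separate. -/
lemma accumulator_minCut_eq (μ : ℕ) (x : G.Copy) :
    (G.accumulator μ).transform.minCut .source (.copy x) =
      (G.accumulatorTransform μ).minCut .source (.copy x) := by
  have hfin : Finite (G.accumulatorTransform μ).Edge :=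
    inferInstanceAs (Finite (G.Ext ⊕ (G.MemStep × Fin μ)))
  have hin : ∀ e y, y ∈ (G.accumulator μ).inputs (Sum.inr e) :=
    fun o y => Or.inr (Finset.mem_univ _)
  have hcell : ∀ (c : G.Copy) (j j' : Fin μ),
      (Sum.inl j' : (G.accumulator μ).Input) ∈ (G.accumulator μ).inputs (Sum.inl (c, j)) ↔
        j = j' := by
    intro c j j'
    constructor
    · rintro (h | h)
      · exact Sum.inl.inj (Option.some.inj h)
      · obtain ⟨a, -, ha⟩ := Finset.mem_map.1 h
        cases ha
    · rintro rfl
      exact Or.inl rfl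
  have harr : ∀ (c : G.Copy) (j : Fin μ) (a : G.Ext), c.1 ∈ G.arr a →
      (Sum.inr a : (G.accumulator μ).Input) ∈ (G.accumulator μ).inputs (Sum.inl (c, j)) := by
    intro c j a h
    exact Or.inr (Finset.mem_map_of_mem _ (Finset.mem_filter.2 ⟨Finset.mem_univ _, h⟩))
  apply le_antisymm
  · obtain ⟨W, hs, hx, hcard⟩ := (G.accumulatorTransform μ).exists_ncard_eq_minCut
      (s := .source) (x := .copy x) (fun h => by cases h)
    rw [← hcard]
    set W' : Set (G.accumulator μ).TVertex := {z | match z with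
      | .source => True
      | .copy c => .copy c ∈ W
      | .op (Sum.inl (c, j)) => .cell c j ∈ W
      | .op (Sum.inr e) => .copy (G.originCopy e) ∈ W} with hW'
    refine ((G.accumulator μ).transform.minCut_le (s := .source) (x := .copy x) W' trivial hx).trans ?_
    refine Set.ncard_le_ncard (t := (G.accumulatorTransform μ).cutEdges W) ?_ (Set.toFinite _)
    rintro (a | ⟨⟨⟨p, p'⟩, hp⟩, j⟩) ⟨ht, z, hz, hzW⟩
    · have ht' : (G.accumulatorTransform μ).tail (Sum.inl a) ∈ W := by
        rcases a with i | e
        · exact hs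
        · exact ht
      rcases hz with ⟨c, rfl, hc⟩ | ⟨⟨c, j⟩ | e, rfl, ho, -⟩
      · exact ⟨ht', .copy c, ⟨c, hc, Or.inl rfl⟩, hzW⟩
      · exact ⟨ht', .cell c j, ⟨c, ho, Or.inr ⟨j, rfl⟩⟩, hzW⟩
      · exact ⟨ht', .copy (G.originCopy e), ⟨_, ho, Or.inl rfl⟩, hzW⟩
    · rcases hz with rfl | ⟨⟨c, j'⟩ | e, rfl, ho, hj⟩
      · exact ⟨ht, .copy p', Or.inl rfl, hzW⟩
      · obtain rfl := (hcell c j' j).1 hj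
        have hc : c = p' := ho
        subst hc
        exact ⟨ht, .cell c j', Or.inr rfl, hzW⟩
      · have hc : G.originCopy e = p' := ho
        subst hc
        exact ⟨ht, .copy (G.originCopy e), Or.inl rfl, hzW⟩
  · obtain ⟨W', hs, hx, hcard⟩ := (G.accumulator μ).transform.exists_ncard_eq_minCut
      (s := .source) (x := .copy x) (fun h => by cases h)
    rw [← hcard]
    set W : Set (AccVertex G μ) := {z | match z with
      | .source => True
      | .copy c => .copy c ∈ W' ∧ ∀ e, G.originCopy e = c → .op (Sum.inr e) ∈ W'
      | .cell c j => .op (Sum.inl (c, j)) ∈ W'} with hW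
    refine ((G.accumulatorTransform μ).minCut_le (s := .source) (x := .copy x) W trivial
      (fun h => hx (And.left h))).trans ?_
    refine Set.ncard_le_ncard (t := (G.accumulator μ).transform.cutEdges W') ?_ (Set.toFinite _)
    rintro (a | ⟨⟨⟨p, p'⟩, hp⟩, j⟩) ⟨ht, z, hz, hzW⟩
    · have ht' : (G.accumulator μ).transform.tail (Sum.inl a) ∈ W' := by
        rcases a with i | e
        · exact hs
        · exact ht.2 e rfl
      obtain ⟨c, hc, rfl | ⟨j, rfl⟩⟩ := hz
      · by_contra hcon
        refine hzW ⟨?_, fun e he => ?_⟩ <;> by_contra h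
        · exact hcon ⟨ht', _, Or.inl ⟨c, rfl, hc⟩, h⟩
        · exact hcon ⟨ht', _, Or.inr ⟨Sum.inr e, rfl,
            (congrArg (fun c : G.Copy => c.1 ∈ G.arr a) he).mpr hc, hin _ _⟩, h⟩
      · exact ⟨ht', _, Or.inr ⟨Sum.inl (c, j), rfl, hc, harr c j a hc⟩, hzW⟩
    · rcases hz with rfl | rfl
      · by_contra hcon
        refine hzW ⟨?_, fun e he => ?_⟩ <;> by_contra h
        · exact hcon ⟨ht, _, Or.inl rfl, h⟩
        · exact hcon ⟨ht, _, Or.inr ⟨Sum.inr e, rfl, he, hin _ _⟩, h⟩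
      · exact ⟨ht, _, Or.inr ⟨Sum.inl (p', j), rfl, rfl, (hcell p' j j).2 rfl⟩, hzW⟩

end Schedule

/-! ### The choice of the constant -/

/-- A polynomial with natural coefficients is bounded by a power on the integers `n ≥ 2`. -/
lemma Polynomial.exists_eval_le_pow (P : Polynomial ℕ) :
    ∃ K : ℕ, ∀ n : ℕ, 2 ≤ n → P.eval n ≤ n ^ K := by
  induction P using Polynomial.induction_on with
  | C a =>
    refine ⟨a, fun n hn => ?_⟩
    rw [Polynomial.eval_C]
    exact Nat.lt_two_pow_self.le.trans (Nat.pow_le_pow_left hn a)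
  | add p q hp hq =>
    obtain ⟨K, hK⟩ := hp
    obtain ⟨L, hL⟩ := hq
    -- The extra factor `n ≥ 2` absorbs the sum of two powers.
    refine ⟨max K L + 1, fun n hn => ?_⟩
    have h1 := (hK n hn).trans (Nat.pow_le_pow_right (by omega) (le_max_left K L))
    have h2 := (hL n hn).trans (Nat.pow_le_pow_right (by omega) (le_max_right K L))
    rw [Polynomial.eval_add, pow_succ]
    nlinarith
  | monomial m a h =>
    obtain ⟨K, hK⟩ := h
    refine ⟨K + 1, fun n hn => ?_⟩
    have h1 := Nat.mul_le_mul_right n (hK n hn)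
    rw [_root_.pow_succ n K]
    simpa [_root_.pow_succ, mul_assoc] using h1

theorem lemma3 (P : Polynomial ℕ) (c : ℕ) :
    ∃ C : ℝ, 0 < C ∧
      ∀ (n k l : ℕ) (F : Type) [Field F] [Fintype F] (G : Schedule n k)
        (msg : Fin k → Fin l → F) (x : G.Copy),
        C * Real.log n ≤ Real.log (Fintype.card F) →
        -- any network coding protocol
        (∀ X : G.Protocol, X.numCoding ≤ P.eval n →
          1 - 1 / (n : ℝ) ^ c ≤
            X.prob {ω : X.Coeffs F |
              X.information ω msg x = X.transform.minCut .source (.copy x)}) ∧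
        -- PNC
        (G.pnc.numCoding ≤ P.eval n →
          1 - 1 / (n : ℝ) ^ c ≤
            G.pnc.prob {ω : G.pnc.Coeffs F |
              G.pnc.information ω msg x = G.pncTransform.minCut none (some x)}) ∧
        -- the recombinator
        (∀ μ : ℕ, (G.recombinator μ).numCoding ≤ P.eval n →
          1 - 1 / (n : ℝ) ^ c ≤
            (G.recombinator μ).prob {ω : (G.recombinator μ).Coeffs F |
              (G.recombinator μ).information ω msg x =
                (G.recombinatorTransform μ).minCut none (some x)}) ∧
        -- the accumulator
        (∀ μ : ℕ, (G.accumulator μ).numCoding ≤ P.eval n →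
          1 - 1 / (n : ℝ) ^ c ≤
            (G.accumulator μ).prob {ω : (G.accumulator μ).Coeffs F |
              (G.accumulator μ).information ω msg x =
                (G.accumulatorTransform μ).minCut .source (.copy x)}) := by
  obtain ⟨K, hK⟩ := P.exists_eval_le_pow
  -- The hypothesis on `q` gives `q ≥ n ^ (K + c + 1)`, and `n ^ (K + c)` is already enough to push
  -- `n ^ K / q` below `n ^ (-c)`. The additional `1` keeps the constant positive.
  refine ⟨(K + c + 1 : ℕ), by positivity, ?_⟩
  intro n k l F _ _ G msg x hq
  have main : ∀ X : G.Protocol, X.numCoding ≤ P.eval n →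
      1 - 1 / (n : ℝ) ^ c ≤ X.prob {ω : X.Coeffs F |
        X.information ω msg x = X.transform.minCut .source (.copy x)} := by
    intro X hX
    have hn0 : 0 < n := Fin.pos x.1.1
    -- For `n = 1` the condition on `q` is void, but so is the claim, since the error bound is `1`.
    rcases Nat.lt_or_ge n 2 with hn | hn
    · have hn1 : n = 1 := by omega
      have : 1 - 1 / (n : ℝ) ^ c = 0 := by simp [hn1]
      rw [this]
      exact div_nonneg (Nat.cast_nonneg _) (Nat.cast_nonneg _)
    · refine le_trans ?_ (X.one_sub_le_prob msg x)
      have hnpos : (0 : ℝ) < n := by exact_mod_cast hn0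
      have hqpos : (0 : ℝ) < Fintype.card F := by exact_mod_cast Fintype.card_pos
      have h1 : (n : ℝ) ^ (K + c + 1) ≤ Fintype.card F := by
        rw [← Real.log_pow] at hq
        exact (Real.log_le_log_iff (by positivity) hqpos).1 hq
      have h2 : (X.numCoding : ℝ) ≤ (n : ℝ) ^ K := by exact_mod_cast hX.trans (hK n hn)
      have h3 : (n : ℝ) ^ (K + c) ≤ (n : ℝ) ^ (K + c + 1) :=
        pow_le_pow_right₀ (by exact_mod_cast hn0) (Nat.le_succ _)
      rw [sub_le_sub_iff_left, div_le_div_iff₀ hqpos (by positivity), one_mul]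
      calc (X.numCoding : ℝ) * (n : ℝ) ^ c ≤ (n : ℝ) ^ K * (n : ℝ) ^ c := by gcongr
        _ = (n : ℝ) ^ (K + c) := (pow_add _ _ _).symm
        _ ≤ _ := h3.trans h1
  refine ⟨main, fun h => ?_, fun μ h => ?_, fun μ h => ?_⟩
  · rw [← G.pnc_minCut_eq]
    exact main _ h
  · rw [← G.recombinator_minCut_eq]
    exact main _ h
  · rw [← G.accumulator_minCut_eq]
    exact main _ h
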